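/- **Setting.** Let $n\ge 2$ and $p>q\ge 1$ be integers. Let $\mathbb{C}_{2n}$ be the complex Clifford algebra with generators $e_1,\dots,e_{2n}$, $e_je_k+e_ke_j=-2\delta_{jk}$. Write $X\mapsto\overline X$ for complex conjugation of the coefficients with respect to the basis $(e_A)$, and $X\mapsto X^\dagger$ for the conjugate-linear anti-automorphism with $e_j^\dagger=-e_j$. Put $f_j=\frac12(e_j-ie_{n+j})$, $f_j^\dagger=-\frac12(e_j+ie_{n+j})$ for $1\le j\le n$, $\beta=\sum_j f_j^\dagger f_j$, and $X\wedge Y=\frac12(XY-YX)$. For $z,u\in\mathbb{C}^n$ put $$\underline z=\sum_j f_jz_j,\qquad \underline z^\dagger=\sum_j f_j^\dagger\overline{z_j},\qquad \langle z,u\rangle=\sum_j z_j\overline{u_j},\qquad s=\frac{\langle z,u\rangle\overline{\langle z,u\rangle}}{\langle z,z\rangle\langle u,u\rangle}.$$ The Hermitian Dirac operators are $\partial_{\underline z}=\sum_j f_j^\dagger\,\partial_{z_j}$ and $\partial_{\underline z}^\dagger=\sum_j f_j\,\partial_{\overline z_j}$ with $\partial_{z_j}=\frac12(\partial_{x_j}-i\partial_{x_{n+j}})$,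 $\partial_{\overline z_j}=\frac12(\partial_{x_j}+i\partial_{x_{n+j}})$, $z_j=x_j+ix_{n+j}$; written on the right of a function they act from the right, the one nearest to the function first. The same notation is used for $u$. Let $P_k^{a,b}$ be the Jacobi polynomials, $$P_k^{a,b}(x)=\frac{\Gamma(a+k+1)}{k!\,\Gamma(a+b+k+1)}\sum_{j=0}^k\binom kj\frac{\Gamma(a+b+k+j+1)}{\Gamma(a+j+1)}\Big(\frac{x-1}{2}\Big)^j,$$ and let $c_{p+1,q+1}=\frac{n+1+p+q}{n-1}$. Consider the harmonic kernels $$K_{p+1,q+1}(z,u)=c_{p+1,q+1}\,\langle z,u\rangle^{p-q}\langle z,z\rangle^{q+1}\langle u,u\rangle^{q+1}P_{q+1}^{n-2,p-q}(2s-1),$$ $$K_{q+1,p+1}(z,u)=c_{p+1,q+1}\,\overline{\langle z,u\rangle}^{\,p-q}\langle z,z\rangle^{q+1}\langle u,u\rangle^{q+1}P_{q+1}^{n-2,p-q}(2s-1).$$ These are polynomial functions; at $z=0$ or $u=0$ they are extended by their value $0$. **Statement.** The following hold. 1. (Hermitian symmetry) $K_{p+1,q+1}(z,u)=\overline{K_{q+1,p+1}(z,u)}=K_{q+1,p+1}(u,z)$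 for all $z,u\in\mathbb{C}^n$. 2. $\partial_{\underline z}^\dagger=-\overline{\partial_{\underline z}}$ (acting from the left or from the right; here $\overline{\partial_{\underline z}}\,g$ denotes $\overline{\partial_{\underline z}\overline g}$ for a $\mathbb{C}_{2n}$-valued function $g$, and likewise from the right) and $\underline z^\dagger=-\overline{\underline z}$. 3. For all $z,u\in\mathbb{C}^n$, $$\partial_{\underline z}^\dagger\partial_{\underline z}K_{q+1,p+1}(z,u)\,\partial_{\underline u}^\dagger\partial_{\underline u} =\Big(\partial_{\underline u}\partial_{\underline u}^\dagger\,\overline{K_{q+1,p+1}(z,u)}\,\partial_{\underline z}\partial_{\underline z}^\dagger\Big)^\dagger =\overline{\Big(\partial_{\underline u}^\dagger\partial_{\underline u}K_{p+1,q+1}(u,z)\,\partial_{\underline z}^\dagger\partial_{\underline z}\Big)^\dagger}.$$ 4. Explicitly, omitting the argument $2s-1$ of the Jacobi polynomials, for all $z,u\in\mathbb{C}^n$, $$\begin{aligned} \partial_{\underline z}^\dagger\partial_{\underline z}&K_{q+1,p+1}(z,u)\,\partial_{\underline u}^\dagger\partial_{\underline u} = c_{p+1,q+1}(p+1)(n+p+q+1)\,\overline{\langle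 z,u\rangle}^{\,p-q-1}\langle z,z\rangle^{q-1}\langle u,u\rangle^{q-1}\\ \times\Big(&\overline{\langle z,u\rangle}\langle z,z\rangle\langle u,u\rangle\,(n-\beta+p)(\beta+q)\,P_q^{n-1,p-q}\\ &-\overline{\langle z,u\rangle}\langle z,z\rangle\,p\,(n-\beta+p)\,\underline u^\dagger\wedge\underline u\,P_{q-1}^{n,p-q} -\overline{\langle z,u\rangle}\langle u,u\rangle\,p\,(n-\beta+p)\,\underline z^\dagger\wedge\underline z\,P_{q-1}^{n,p-q}\\ &-\overline{\langle z,u\rangle}^{\,2}(n+p)(n-\beta+p)\,\underline z\,\underline u^\dagger\,P_{q-1}^{n,p-q+1} -\langle z,z\rangle\langle u,u\rangle\,p\,(\beta+q)\,\underline z^\dagger\underline u\,P_q^{n,p-q-1}\\ &+\overline{\langle z,u\rangle}\,p\,(n+p+q)\,\underline z^\dagger\underline z\,\underline u^\dagger\underline u\,P_{q-1}^{n,p-q}\Big), \end{aligned}$$ where at $z=0$ or $u=0$ both sides are $0$. -/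

import Mathlib

open scoped TensorProduct BigOperators ComplexConjugate

noncomputable section

namespace HermitianClifford

/-! ### The complex Clifford algebra of dimension `2 n` -/

/-- The negative definite form `x ↦ - ∑ x_j ^ 2` on `ℝ ^ (2 n)`; with it `e_j e_k + e_k e_j = - 2 δ_jk`. -/
def form (n : ℕ) : QuadraticForm ℝ (Fin (n + n) → ℝ) :=
  QuadraticMap.weightedSumSquares ℝ (fun _ : Fin (n + n) => (-1 : ℝ))

/-- `ℂ_{2n} = Cl_{2n} ⊕ i Cl_{2n}`, the complexification of the real Clifford algebra. -/
abbrev Cl (n : ℕ) : Type := ℂ ⊗[ℝ] CliffordAlgebra (form n)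

/-- The basis vectors `e_1, …, e_{2n}`. -/
def e {n : ℕ} (i : Fin (n + n)) : Cl n :=
  (1 : ℂ) ⊗ₜ[ℝ] CliffordAlgebra.ι (form n) (Pi.single i 1)

/-- Complex conjugation of the coefficients, `∑ e_A X_A ↦ ∑ e_A conj X_A`. -/
def conjCl {n : ℕ} : Cl n →ₐ[ℝ] Cl n :=
  Algebra.TensorProduct.map (Complex.conjAe : ℂ →ₐ[ℝ] ℂ) (AlgHom.id ℝ (CliffordAlgebra (form n)))

/-- Hermitian (Clifford) conjugation `X ↦ X†`: the conjugate-linear anti-automorphism with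
`e_j† = - e_j`. -/
def dagger {n : ℕ} : Cl n →ₗ[ℝ] Cl n :=
  TensorProduct.map (Complex.conjAe : ℂ →ₐ[ℝ] ℂ).toLinearMap
    (CliffordAlgebra.reverse ∘ₗ (CliffordAlgebra.involute (Q := form n)).toLinearMap)

/-- The Witt basis element `f_j = (e_j - i e_{n+j}) / 2`. -/
def f {n : ℕ} (j : Fin n) : Cl n :=
  (1 / 2 : ℂ) • (e (Fin.castAdd n j) - Complex.I • e (Fin.natAdd n j))

/-- The Witt basis element `f_j† = - (e_j + i e_{n+j}) / 2`. -/
def fDag {n : ℕ} (j : Fin n) : Cl n :=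
  -((1 / 2 : ℂ) • (e (Fin.castAdd n j) + Complex.I • e (Fin.natAdd n j)))

/-- The Hermitian vector variable `∑ f_j z_j`. -/
def vec {n : ℕ} (z : Fin n → ℂ) : Cl n := ∑ j, z j • f j

/-- The conjugate vector variable `∑ f_j† conj z_j`. -/
def vecDag {n : ℕ} (z : Fin n → ℂ) : Cl n := ∑ j, conj (z j) • fDag j

/-- The Clifford number `β = ∑ f_j† f_j`. -/
def beta (n : ℕ) : Cl n := ∑ j : Fin n, fDag j * f j

/-- The wedge product of two Clifford vectors, the antisymmetric part of their product. -/
def wedge {n : ℕ} (X Y : Cl n) : Cl n := (1 / 2 : ℂ) • (X * Y - Y * X)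

/-! ### Wirtinger derivatives and Hermitian Dirac operators -/

/-- The basis `(e_A)`, `A ⊆ {1, …, 2n}`, of the Clifford algebra over `ℂ`. -/
def clBasis (n : ℕ) : Module.Basis (Finset (Fin (n + n))) ℂ (Cl n) :=
  Algebra.TensorProduct.basis ℂ
    ((Pi.basisFun ℝ (Fin (n + n))).ExteriorAlgebra.map (CliffordAlgebra.equivExterior (form n)).symm)

/-- The real partial derivative of `g = ∑ e_A g_A` at `z` in the direction `v`, taken
coefficient by coefficient (so that it does not depend on the choice of the basis for
differentiable `g`). -/
def pderiv {n : ℕ} (g : (Fin n → ℂ) → Cl n) (z v : Fin n → ℂ) : Cl n :=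
  ∑ A, lineDeriv ℝ (fun w => (clBasis n).repr (g w) A) z v • clBasis n A

/-- `∂_{z_j} = (∂_{x_j} - i ∂_{x_{n+j}}) / 2`, where `z_j = x_j + i x_{n+j}`. -/
def dz {n : ℕ} (j : Fin n) (g : (Fin n → ℂ) → Cl n) (z : Fin n → ℂ) : Cl n :=
  (1 / 2 : ℂ) • (pderiv g z (Pi.single j 1) - Complex.I • pderiv g z (Pi.single j Complex.I))

/-- The conjugate derivative `(∂_{x_j} + i ∂_{x_{n+j}}) / 2`. -/
def dzbar {n : ℕ} (j : Fin n) (g : (Fin n → ℂ) → Cl n) (z : Fin n → ℂ) : Cl n :=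
  (1 / 2 : ℂ) • (pderiv g z (Pi.single j 1) + Complex.I • pderiv g z (Pi.single j Complex.I))

/-- The Dirac operator `∂_z = ∑ f_j† ∂_{z_j}` acting from the left. -/
def diracL {n : ℕ} (g : (Fin n → ℂ) → Cl n) (z : Fin n → ℂ) : Cl n := ∑ j, fDag j * dz j g z

/-- The Dirac operator `∂_z† = ∑ f_j conj ∂_{z_j}` acting from the left. -/
def diracDagL {n : ℕ} (g : (Fin n → ℂ) → Cl n) (z : Fin n → ℂ) : Cl n := ∑ j, f j * dzbar j g z

/-- The Dirac operator `∂_z` acting from the right. -/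
def diracR {n : ℕ} (g : (Fin n → ℂ) → Cl n) (z : Fin n → ℂ) : Cl n := ∑ j, dz j g z * fDag j

/-- The Dirac operator `∂_z†` acting from the right. -/
def diracDagR {n : ℕ} (g : (Fin n → ℂ) → Cl n) (z : Fin n → ℂ) : Cl n := ∑ j, dzbar j g z * f j

/-- For a scalar function `F` of two vector variables `x`, `y`, the function
`∂_x† ∂_x F(x, y) ∂_y† ∂_y`: from the left first `∂_x`, then `∂_x†`, from the right first `∂_y†`,
then `∂_y`. -/
def fourDirac {n : ℕ} (F : (Fin n → ℂ) → (Fin n → ℂ) → ℂ) (x y : Fin n → ℂ) : Cl n :=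
  diracR (diracDagR fun y' =>
    diracDagL (diracL fun x' => algebraMap ℂ (Cl n) (F x' y')) x) y

/-- For a scalar function `F` of two vector variables `x`, `y`, the function
`∂_x ∂_x† F(x, y) ∂_y ∂_y†`: from the left first `∂_x†`, then `∂_x`, from the right first `∂_y`,
then `∂_y†`. -/
def fourDirac' {n : ℕ} (F : (Fin n → ℂ) → (Fin n → ℂ) → ℂ) (x y : Fin n → ℂ) : Cl n :=
  diracDagR (diracR fun y' =>
    diracL (diracDagL fun x' => algebraMap ℂ (Cl n) (F x' y')) x) y

/-! ### Jacobi polynomials and the harmonic kernels -/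

/-- The Hermitian inner product `⟨z, u⟩ = ∑ z_j conj u_j`. -/
def herm {n : ℕ} (z u : Fin n → ℂ) : ℂ := ∑ j, z j * conj (u j)

/-- The angular variable `s = |⟨z, u⟩|² / (⟨z, z⟩ ⟨u, u⟩)`. -/
def angular {n : ℕ} (z u : Fin n → ℂ) : ℂ :=
  herm z u * conj (herm z u) / (herm z z * herm u u)

/-- The Jacobi polynomial `P_k^{a,b}`, for `a, b > -1`. -/
def jacobiP (k : ℕ) (a b : ℝ) (x : ℂ) : ℂ :=
  ((Real.Gamma (a + k + 1) / ((k.factorial : ℝ) * Real.Gamma (a + b + k + 1)) : ℝ) : ℂ) *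
    ∑ j ∈ Finset.range (k + 1),
      (((k.choose j : ℝ) * (Real.Gamma (a + b + k + j + 1) / Real.Gamma (a + j + 1)) : ℝ) : ℂ) *
        ((x - 1) / 2) ^ j

/-- The constant `c_{p,q} = (ν + 1 + p + q) / (ν + 1)`, `ν = n - 2`. -/
def kernelConst (n p q : ℕ) : ℂ := ((n : ℂ) - 2 + 1 + p + q) / ((n : ℂ) - 2 + 1)

/-- The harmonic kernel `K_{p,q}^n` of homogeneity `(p, q)`. It is a polynomial function: where
`z = 0` or `u = 0`, so that the angular variable is not defined, a positive power of
`⟨z, u⟩`, `⟨z, z⟩` or `⟨u, u⟩` makes it vanish (unless `p = q = 0`, where it is `1`). -/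
def harmonicKernel (n p q : ℕ) (z u : Fin n → ℂ) : ℂ :=
  if q ≤ p then
    kernelConst n p q * herm z u ^ (p - q) * herm z z ^ q * herm u u ^ q *
      jacobiP q ((n : ℝ) - 2) ((p : ℝ) - q) (2 * angular z u - 1)
  else
    kernelConst n p q * conj (herm z u) ^ (q - p) * herm z z ^ p * herm u u ^ p *
      jacobiP p ((n : ℝ) - 2) ((q : ℝ) - p) (2 * angular z u - 1)

end HermitianClifford

end

open HermitianClifford

namespace HermitianClifford

variable {n : ℕ}

/-- The scalar function `φ` has Wirtinger derivatives `a j = ∂φ/∂z_j` and `b j = ∂φ/∂z̄_j` at `z`. -/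
def HasWirtScalar (φ : (Fin n → ℂ) → ℂ) (a b : Fin n → ℂ) (z : Fin n → ℂ) : Prop :=
  ∀ v : Fin n → ℂ, HasLineDerivAt ℝ φ (∑ j, (v j * a j + conj (v j) * b j)) z v

/-- The Clifford algebra valued function `g` has Wirtinger derivatives `a j = ∂g/∂z_j` and
`b j = ∂g/∂z̄_j` at `z`. -/
def HasWirt (g : (Fin n → ℂ) → Cl n) (a b : Fin n → Cl n) (z : Fin n → ℂ) : Prop :=
  ∀ (A : Finset (Fin (n + n))) (v : Fin n → ℂ),
    HasLineDerivAt ℝ (fun w => (clBasis n).repr (g w) A)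
      ((clBasis n).repr (∑ j, (v j • a j + conj (v j) • b j)) A) z v

namespace HasWirtScalar

variable {φ ψ : (Fin n → ℂ) → ℂ} {a b a' b' : Fin n → ℂ} {z : Fin n → ℂ}

theorem const (c : ℂ) : HasWirtScalar (fun _ => c) 0 0 z := fun v => by
  have : HasLineDerivAt ℝ (fun _ : Fin n → ℂ => c) 0 z v := hasDerivAt_const (0 : ℝ) c
  simpa using this

theorem add (h : HasWirtScalar φ a b z) (h' : HasWirtScalar ψ a' b' z) :
    HasWirtScalar (fun w => φ w + ψ w) (a + a') (b + b') z := fun v => by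
  have := HasDerivAt.add (h v) (h' v)
  refine HasDerivAt.congr_deriv this ?_
  rw [← Finset.sum_add_distrib]
  exact Finset.sum_congr rfl fun j _ => by simp only [Pi.add_apply]; ring

theorem mul (h : HasWirtScalar φ a b z) (h' : HasWirtScalar ψ a' b' z) :
    HasWirtScalar (fun w => φ w * ψ w) (fun j => a j * ψ z + φ z * a' j)
      (fun j => b j * ψ z + φ z * b' j) z := fun v => by
  have := HasDerivAt.mul (h v) (h' v)
  refine HasDerivAt.congr_deriv this ?_
  simp only [zero_smul, add_zero]
  rw [Finset.sum_mul, Finset.mul_sum, ← Finset.sum_add_distrib]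
  exact Finset.sum_congr rfl fun j _ => by ring

theorem congr_derivs (h : HasWirtScalar φ a b z) (ha : a = a') (hb : b = b') :
    HasWirtScalar φ a' b' z := ha ▸ hb ▸ h

theorem sum {ι : Type*} (s : Finset ι) {Φ : ι → (Fin n → ℂ) → ℂ} {a b : ι → Fin n → ℂ}
    (h : ∀ i ∈ s, HasWirtScalar (Φ i) (a i) (b i) z) :
    HasWirtScalar (fun w => ∑ i ∈ s, Φ i w) (∑ i ∈ s, a i) (∑ i ∈ s, b i) z := by
  classical
  induction s using Finset.induction_on with
  | empty => simpa using const 0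
  | insert i s hi ih =>
    simp only [Finset.sum_insert hi]
    exact (h i (by simp)).add (ih fun k hk => h k (by simp [hk]))

theorem star (h : HasWirtScalar φ a b z) :
    HasWirtScalar (fun w => (starRingEnd ℂ) (φ w)) (fun j => (starRingEnd ℂ) (b j))
      (fun j => (starRingEnd ℂ) (a j)) z := fun v => by
  have := (h v).star
  refine HasDerivAt.congr_deriv this ?_
  simp only [star_sum, star_add, star_mul, RCLike.star_def]
  refine Finset.sum_congr rfl fun j _ => ?_
  simp
  ring

theorem coord (j : Fin n) : HasWirtScalar (fun w => w j) (Pi.single j 1) 0 z := fun v => by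
  have : HasDerivAt (fun t : ℝ => z j + t * v j) (v j) 0 := by
    simpa using ((Complex.ofRealCLM.hasDerivAt (x := 0)).mul_const (v j)).const_add (z j)
  refine HasDerivAt.congr_deriv (f' := v j) ?_ ?_
  · simpa using this
  · simp [Pi.single_apply]

theorem eval {σ : Type*} [Fintype σ] (P : MvPolynomial σ ℂ) {x : σ → (Fin n → ℂ) → ℂ}
    {a b : σ → Fin n → ℂ} (h : ∀ i, HasWirtScalar (x i) (a i) (b i) z) :
    HasWirtScalar (fun w => MvPolynomial.eval (fun i => x i w) P)
      (fun j => ∑ i, MvPolynomial.eval (fun i => x i z) (MvPolynomial.pderiv i P) * a i j)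
      (fun j => ∑ i, MvPolynomial.eval (fun i => x i z) (MvPolynomial.pderiv i P) * b i j) z := by
  classical
  induction P using MvPolynomial.induction_on with
  | C c =>
    simp only [MvPolynomial.eval_C, MvPolynomial.pderiv_C, map_zero, zero_mul,
      Finset.sum_const_zero]
    exact const c
  | add P Q hP hQ =>
    have := hP.add hQ
    simp only [map_add]
    refine this.congr_derivs ?_ ?_ <;>
    · funext j
      simp [add_mul, Finset.sum_add_distrib]
  | mul_X P i hP =>
    have := hP.mul (h i)
    simp only [map_mul, MvPolynomial.eval_X]
    refine this.congr_derivs ?_ ?_ <;>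
    · funext j
      simp only [Derivation.leibniz, MvPolynomial.pderiv_X, smul_eq_mul, map_add, map_mul,
        MvPolynomial.eval_X, add_mul, Finset.sum_add_distrib, Pi.single_apply,
        apply_ite, map_one, map_zero]
      simp [Finset.sum_mul]
      rw [add_comm]
      congr 1
      exact Finset.sum_congr rfl fun _ _ => by ring

end HasWirtScalar

namespace HasWirt

variable {g h : (Fin n → ℂ) → Cl n} {a b a' b' : Fin n → Cl n} {z : Fin n → ℂ}

theorem congr_derivs (h : HasWirt g a b z) (ha : a = a') (hb : b = b') :
    HasWirt g a' b' z := ha ▸ hb ▸ h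

theorem pderiv_eq (hg : HasWirt g a b z) (v : Fin n → ℂ) :
    pderiv g z v = ∑ j, (v j • a j + conj (v j) • b j) := by
  rw [pderiv, ← (clBasis n).sum_repr (∑ j, (v j • a j + conj (v j) • b j))]
  exact Finset.sum_congr rfl fun A _ => by rw [(hg A v).lineDeriv]

theorem dz_eq (hg : HasWirt g a b z) (j : Fin n) : dz j g z = a j := by
  rw [dz, hg.pderiv_eq, hg.pderiv_eq]
  rw [Finset.sum_eq_single j, Finset.sum_eq_single j]
  · simp only [Pi.single_eq_same, map_one, Complex.conj_I]
    match_scalars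
    · linear_combination (-1 / 2 : ℂ) * Complex.I_mul_I
    · linear_combination (1 / 2 : ℂ) * Complex.I_mul_I
  all_goals simp +contextual

theorem dzbar_eq (hg : HasWirt g a b z) (j : Fin n) : dzbar j g z = b j := by
  rw [dzbar, hg.pderiv_eq, hg.pderiv_eq]
  rw [Finset.sum_eq_single j, Finset.sum_eq_single j]
  · simp only [Pi.single_eq_same, map_one, Complex.conj_I]
    match_scalars
    · linear_combination (1 / 2 : ℂ) * Complex.I_mul_I
    · linear_combination (- 1 / 2 : ℂ) * Complex.I_mul_I
  all_goals simp +contextual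

theorem add (hg : HasWirt g a b z) (hh : HasWirt h a' b' z) :
    HasWirt (fun w => g w + h w) (a + a') (b + b') z := fun A v => by
  have := HasDerivAt.add (hg A v) (hh A v)
  simp only [map_add, Finsupp.add_apply]
  refine HasDerivAt.congr_deriv this ?_
  rw [← Finsupp.add_apply, ← map_add, ← Finset.sum_add_distrib]
  congr 2
  exact Finset.sum_congr rfl fun j _ => by simp only [Pi.add_apply]; module

theorem const (X : Cl n) : HasWirt (fun _ => X) 0 0 z := fun A v => by
  have : HasLineDerivAt ℝ (fun _ : Fin n → ℂ => (clBasis n).repr X A) 0 z v :=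
    hasDerivAt_const (0 : ℝ) _
  simpa using this

theorem sum {ι : Type*} (s : Finset ι) {Φ : ι → (Fin n → ℂ) → Cl n} {a b : ι → Fin n → Cl n}
    (h : ∀ i ∈ s, HasWirt (Φ i) (a i) (b i) z) :
    HasWirt (fun w => ∑ i ∈ s, Φ i w) (∑ i ∈ s, a i) (∑ i ∈ s, b i) z := by
  classical
  induction s using Finset.induction_on with
  | empty => simpa using const 0
  | insert i s hi ih =>
    simp only [Finset.sum_insert hi]
    exact (h i (by simp)).add (ih fun k hk => h k (by simp [hk]))

theorem smul {φ : (Fin n → ℂ) → ℂ} {c d : Fin n → ℂ} (hφ : HasWirtScalar φ c d z)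
    (hg : HasWirt g a b z) :
    HasWirt (fun w => φ w • g w) (fun j => c j • g z + φ z • a j)
      (fun j => d j • g z + φ z • b j) z := fun A v => by
  have := HasDerivAt.mul (hφ v) (hg A v)
  simp only [map_smul, Finsupp.smul_apply, smul_eq_mul]
  refine HasDerivAt.congr_deriv this ?_
  simp only [zero_smul, add_zero]
  rw [← smul_eq_mul, ← smul_eq_mul, ← Finsupp.smul_apply, ← Finsupp.smul_apply, ← map_smul,
    ← map_smul, ← Finsupp.add_apply, ← map_add, Finset.sum_smul, Finset.smul_sum,
    ← Finset.sum_add_distrib]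
  congr 2
  exact Finset.sum_congr rfl fun j _ => by module

theorem smul_const {φ : (Fin n → ℂ) → ℂ} {c d : Fin n → ℂ} (hφ : HasWirtScalar φ c d z)
    (X : Cl n) : HasWirt (fun w => φ w • X) (fun j => c j • X) (fun j => d j • X) z :=
  (smul hφ (const X)).congr_derivs (by funext j; simp) (by funext j; simp)

theorem repr_mul (X Y : Cl n) (A : Finset (Fin (n + n))) :
    (clBasis n).repr (X * Y) A = ∑ B, ∑ C, (clBasis n).repr X B * (clBasis n).repr Y C *
      (clBasis n).repr (clBasis n B * clBasis n C) A := by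
  conv_lhs => rw [← (clBasis n).sum_repr X, ← (clBasis n).sum_repr Y]
  simp only [Finset.sum_mul_sum, smul_mul_smul_comm, map_sum, map_smul, Finsupp.coe_finsetSum,
    Finset.sum_apply, Finsupp.smul_apply, smul_eq_mul]

theorem mul (hg : HasWirt g a b z) (hh : HasWirt h a' b' z) :
    HasWirt (fun w => g w * h w) (fun j => a j * h z + g z * a' j)
      (fun j => b j * h z + g z * b' j) z := fun A v => by
  have := HasDerivAt.fun_sum (u := Finset.univ) fun B _ =>
    HasDerivAt.fun_sum (u := Finset.univ) fun C _ => ((hg B v).mul (hh C v)).mul_const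
      ((clBasis n).repr (clBasis n B * clBasis n C) A)
  have key : (fun w => (clBasis n).repr (g w * h w) A) = fun w => ∑ B, ∑ C,
      (clBasis n).repr (g w) B * (clBasis n).repr (h w) C *
        (clBasis n).repr (clBasis n B * clBasis n C) A := funext fun w => repr_mul _ _ A
  rw [key]
  refine HasDerivAt.congr_deriv this ?_
  trans (clBasis n).repr ((∑ j, (v j • a j + conj (v j) • b j)) * h z) A +
    (clBasis n).repr (g z * ∑ j, (v j • a' j + conj (v j) • b' j)) A
  · rw [repr_mul, repr_mul]
    simp only [zero_smul, add_zero, add_mul, Finset.sum_add_distrib]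
  rw [← Finsupp.add_apply, ← map_add, Finset.sum_mul, Finset.mul_sum,
    ← Finset.sum_add_distrib]
  congr 2
  exact Finset.sum_congr rfl fun j _ => by
    simp only [add_mul, mul_add, smul_mul_assoc, mul_smul_comm]; module

theorem const_mul (X : Cl n) (hg : HasWirt g a b z) :
    HasWirt (fun w => X * g w) (fun j => X * a j) (fun j => X * b j) z :=
  ((const X).mul hg).congr_derivs (by funext j; simp) (by funext j; simp)

theorem mul_const (hg : HasWirt g a b z) (X : Cl n) :
    HasWirt (fun w => g w * X) (fun j => a j * X) (fun j => b j * X) z :=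
  (hg.mul (const X)).congr_derivs (by funext j; simp) (by funext j; simp)

theorem vec : HasWirt (vec : (Fin n → ℂ) → Cl n) f 0 z := by
  refine (sum Finset.univ fun j _ => smul_const (.coord j) (f j)).congr_derivs ?_ ?_
  · funext k; simp [Pi.single_apply]
  · funext k; simp

theorem vecDag : HasWirt (vecDag : (Fin n → ℂ) → Cl n) 0 fDag z := by
  refine (sum Finset.univ fun j _ => smul_const (HasWirtScalar.coord j).star (fDag j)).congr_derivs
    ?_ ?_
  · funext k; simp
  · funext k; simp [Pi.single_apply, apply_ite]

theorem diracL_eq (hg : HasWirt g a b z) : diracL g z = ∑ j, fDag j * a j :=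
  Finset.sum_congr rfl fun j _ => by rw [hg.dz_eq]

theorem diracDagL_eq (hg : HasWirt g a b z) : diracDagL g z = ∑ j, f j * b j :=
  Finset.sum_congr rfl fun j _ => by rw [hg.dzbar_eq]

theorem diracR_eq (hg : HasWirt g a b z) : diracR g z = ∑ j, a j * fDag j :=
  Finset.sum_congr rfl fun j _ => by rw [hg.dz_eq]

theorem diracDagR_eq (hg : HasWirt g a b z) : diracDagR g z = ∑ j, b j * f j :=
  Finset.sum_congr rfl fun j _ => by rw [hg.dzbar_eq]

end HasWirt

theorem e_mul_e (i j : Fin (n + n)) :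
    (e i * e j : Cl n) = (if i = j then -2 else 0 : ℂ) • 1 - e j * e i := by
  have h : QuadraticMap.polar (form n) (Pi.single i 1) (Pi.single j 1) = if i = j then -2 else 0 := by
    simp only [QuadraticMap.polar, form, QuadraticMap.weightedSumSquares_apply, Pi.add_apply,
      ← Finset.sum_sub_distrib]
    split_ifs with hij
    · subst hij
      rw [Finset.sum_eq_single i]
      · simp; norm_num
      · simp +contextual
      · simp
    · refine Finset.sum_eq_zero fun k _ => ?_
      by_cases h1 : k = i
      · subst h1; simp [hij]
      · simp [Pi.single_apply, h1]
  rw [eq_sub_iff_add_eq, e, e, Algebra.TensorProduct.tmul_mul_tmul,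
    Algebra.TensorProduct.tmul_mul_tmul, ← TensorProduct.tmul_add,
    CliffordAlgebra.ι_mul_ι_add_swap, h]
  split_ifs
  · rw [Algebra.algebraMap_eq_smul_one, TensorProduct.tmul_smul, Algebra.TensorProduct.one_def,
      TensorProduct.smul_tmul', TensorProduct.smul_tmul']
    simp
  · simp

theorem eq_zero_of_eq_neg {M : Type*} [AddCommGroup M] [Module ℂ M] {x : M} (h : x = -x) :
    x = 0 := by
  have h2 : (2 : ℂ) • x = 0 := by rw [two_smul]; nth_rewrite 2 [h]; exact add_neg_cancel x
  exact (smul_eq_zero.1 h2).resolve_left two_ne_zero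

theorem fDag_eq (j : Fin n) : (fDag j : Cl n) =
    (-1 / 2 : ℂ) • (e (Fin.castAdd n j) + Complex.I • e (Fin.natAdd n j)) := by
  rw [fDag]; module

theorem f_mul_f (j k : Fin n) : (f j * f k : Cl n) = -(f k * f j) := by
  simp only [f, mul_sub, sub_mul, smul_mul_assoc, mul_smul_comm, smul_sub]
  rw [e_mul_e (Fin.castAdd n j) (Fin.castAdd n k), e_mul_e (Fin.castAdd n j) (Fin.natAdd n k),
    e_mul_e (Fin.natAdd n j) (Fin.castAdd n k), e_mul_e (Fin.natAdd n j) (Fin.natAdd n k)]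
  rw [if_neg (c := Fin.castAdd n j = Fin.natAdd n k) (by simp [Fin.ext_iff]; omega),
    if_neg (c := Fin.natAdd n j = Fin.castAdd n k) (by simp [Fin.ext_iff]; omega)]
  simp only [Fin.castAdd_inj, Fin.natAdd_inj]
  match_scalars <;> grind [Complex.I_mul_I]

theorem fDag_mul_fDag (j k : Fin n) : (fDag j * fDag k : Cl n) = -(fDag k * fDag j) := by
  simp only [fDag_eq, mul_add, add_mul, smul_mul_assoc, mul_smul_comm, smul_add]
  rw [e_mul_e (Fin.castAdd n j) (Fin.castAdd n k), e_mul_e (Fin.castAdd n j) (Fin.natAdd n k),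
    e_mul_e (Fin.natAdd n j) (Fin.castAdd n k), e_mul_e (Fin.natAdd n j) (Fin.natAdd n k)]
  rw [if_neg (c := Fin.castAdd n j = Fin.natAdd n k) (by simp [Fin.ext_iff]; omega),
    if_neg (c := Fin.natAdd n j = Fin.castAdd n k) (by simp [Fin.ext_iff]; omega)]
  simp only [Fin.castAdd_inj, Fin.natAdd_inj]
  match_scalars <;> grind [Complex.I_mul_I]

theorem fDag_mul_f (j k : Fin n) :
    (fDag j * f k : Cl n) = (if j = k then 1 else 0 : ℂ) • 1 - f k * fDag j := by
  simp only [f, fDag_eq, mul_add, add_mul, mul_sub, sub_mul, smul_mul_assoc, mul_smul_comm,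
    smul_add, smul_sub]
  rw [e_mul_e (Fin.castAdd n j) (Fin.castAdd n k), e_mul_e (Fin.castAdd n j) (Fin.natAdd n k),
    e_mul_e (Fin.natAdd n j) (Fin.castAdd n k), e_mul_e (Fin.natAdd n j) (Fin.natAdd n k)]
  rw [if_neg (c := Fin.castAdd n j = Fin.natAdd n k) (by simp [Fin.ext_iff]; omega),
    if_neg (c := Fin.natAdd n j = Fin.castAdd n k) (by simp [Fin.ext_iff]; omega)]
  simp only [Fin.castAdd_inj, Fin.natAdd_inj]
  match_scalars <;> grind [Complex.I_mul_I]

theorem vec_mul_vec (z u : Fin n → ℂ) : vec z * vec u = -(vec u * vec z) := by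
  simp only [vec, Finset.sum_mul_sum, ← Finset.sum_neg_distrib]
  rw [Finset.sum_comm]
  refine Finset.sum_congr rfl fun j _ => Finset.sum_congr rfl fun k _ => ?_
  rw [smul_mul_smul_comm, smul_mul_smul_comm, f_mul_f, smul_neg, mul_comm]

theorem vecDag_mul_vecDag (z u : Fin n → ℂ) : vecDag z * vecDag u = -(vecDag u * vecDag z) := by
  simp only [vecDag, Finset.sum_mul_sum, ← Finset.sum_neg_distrib]
  rw [Finset.sum_comm]
  refine Finset.sum_congr rfl fun j _ => Finset.sum_congr rfl fun k _ => ?_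
  rw [smul_mul_smul_comm, smul_mul_smul_comm, fDag_mul_fDag, smul_neg, mul_comm]

theorem vec_mul_self (z : Fin n → ℂ) : vec z * vec z = 0 := eq_zero_of_eq_neg (vec_mul_vec z z)

theorem vecDag_mul_self (z : Fin n → ℂ) : vecDag z * vecDag z = 0 :=
  eq_zero_of_eq_neg (vecDag_mul_vecDag z z)

theorem conj_herm (z u : Fin n → ℂ) : conj (herm z u) = herm u z := by
  simp [herm, mul_comm]

theorem vecDag_mul_f (z : Fin n → ℂ) (k : Fin n) :
    vecDag z * f k = conj (z k) • 1 - f k * vecDag z := by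
  simp only [vecDag, Finset.sum_mul, Finset.mul_sum, smul_mul_assoc, mul_smul_comm, fDag_mul_f,
    smul_sub, Finset.sum_sub_distrib, smul_smul]
  simp [ite_smul]

theorem fDag_mul_vec (z : Fin n → ℂ) (k : Fin n) :
    fDag k * vec z = z k • 1 - vec z * fDag k := by
  simp only [vec, Finset.sum_mul, Finset.mul_sum, smul_mul_assoc, mul_smul_comm, fDag_mul_f,
    smul_sub, Finset.sum_sub_distrib, smul_smul]
  simp [ite_smul]

theorem vecDag_mul_vec (z u : Fin n → ℂ) :
    vecDag z * vec u = conj (herm z u) • 1 - vec u * vecDag z := by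
  rw [vec, Finset.mul_sum, Finset.sum_mul, conj_herm, herm, Finset.sum_smul,
    ← Finset.sum_sub_distrib]
  refine Finset.sum_congr rfl fun j _ => ?_
  rw [mul_smul_comm, vecDag_mul_f, smul_sub, smul_smul, smul_mul_assoc]

theorem vec_mul_f (z : Fin n → ℂ) (j : Fin n) : vec z * f j = -(f j * vec z) := by
  simp only [vec, Finset.sum_mul, Finset.mul_sum, ← Finset.sum_neg_distrib, smul_mul_assoc,
    mul_smul_comm, ← smul_neg]
  exact Finset.sum_congr rfl fun k _ => by rw [f_mul_f]

theorem vecDag_mul_fDag (z : Fin n → ℂ) (j : Fin n) :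
    vecDag z * fDag j = -(fDag j * vecDag z) := by
  simp only [vecDag, Finset.sum_mul, Finset.mul_sum, ← Finset.sum_neg_distrib, smul_mul_assoc,
    mul_smul_comm, ← smul_neg]
  exact Finset.sum_congr rfl fun k _ => by rw [fDag_mul_fDag]

theorem mul_mul_eq_of_anticomm {R : Type*} [Ring R] [Algebra ℂ R] {x y z : R} {c : ℂ}
    (hy : x * y = c • 1 - y * x) (hz : x * z = -(z * x)) : x * (y * z) = y * z * x + c • z := by
  rw [← mul_assoc, hy, sub_mul, mul_assoc, hz, smul_mul_assoc, one_mul, mul_neg, mul_assoc]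
  abel

theorem mul_mul_eq_of_anticomm' {R : Type*} [Ring R] [Algebra ℂ R] {x y z : R} {c : ℂ}
    (hy : x * y = -(y * x)) (hz : x * z = c • 1 - z * x) : x * (y * z) = y * z * x - c • y := by
  rw [← mul_assoc, hy, neg_mul, mul_assoc, hz, mul_sub, mul_smul_comm, mul_one, mul_assoc]
  abel

theorem mul_mul_eq_neg_of_anticomm {R : Type*} [Ring R] {x y z : R} (h : y * z = -(z * y)) :
    x * y * z = -(x * z * y) := by
  rw [mul_assoc, h, mul_neg, mul_assoc]

theorem sum_f_mul_fDag : ∑ j : Fin n, f j * fDag j = (n : ℂ) • 1 - beta n := by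
  simp only [beta, fDag_mul_f, Finset.sum_sub_distrib]
  simp [Nat.cast_smul_eq_nsmul]

theorem vec_mul_beta (z : Fin n → ℂ) : vec z * beta n = beta n * vec z + vec z := by
  have h (j : Fin n) : vec z * (fDag j * f j) = fDag j * f j * vec z + z j • f j :=
    mul_mul_eq_of_anticomm (by rw [fDag_mul_vec]; abel) (vec_mul_f z j)
  simp only [beta, Finset.mul_sum, Finset.sum_mul, h, Finset.sum_add_distrib]
  rfl

theorem vecDag_mul_beta (z : Fin n → ℂ) : vecDag z * beta n = beta n * vecDag z - vecDag z := by
  have h (j : Fin n) :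
      vecDag z * (fDag j * f j) = fDag j * f j * vecDag z - conj (z j) • fDag j :=
    mul_mul_eq_of_anticomm' (vecDag_mul_fDag z j) (vecDag_mul_f z j)
  simp only [beta, Finset.mul_sum, Finset.sum_mul, h, Finset.sum_sub_distrib]
  rfl

theorem sum_f_mul_vecDag_mul_fDag (z : Fin n → ℂ) :
    ∑ j, f j * vecDag z * fDag j = -(((n : ℂ) • 1 - beta n) * vecDag z) := by
  rw [← sum_f_mul_fDag, Finset.sum_mul, ← Finset.sum_neg_distrib]
  exact Finset.sum_congr rfl fun j _ => mul_mul_eq_neg_of_anticomm (vecDag_mul_fDag z j)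

section WittRelations

variable {R : Type*} [Ring R] [Algebra ℂ R]

/-- The relations between two Hermitian vectors `x`, `y`, their conjugates `X`, `Y` and `β`. -/
structure WittRelations (x y X Y b : R) (w v A B : ℂ) : Prop where
  xx : x * x = 0
  yy : y * y = 0
  XX : X * X = 0
  YY : Y * Y = 0
  yx : y * x = -(x * y)
  YX : Y * X = -(X * Y)
  Xx : X * x = A • 1 - x * X
  Xy : X * y = v • 1 - y * X
  Yx : Y * x = w • 1 - x * Y
  Yy : Y * y = B • 1 - y * Y
  xb : x * b = b * x + x
  yb : y * b = b * y + y
  Xb : X * b = b * X - X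
  Yb : Y * b = b * Y - Y

variable {x y X Y b : R} {w v A B : ℂ}

theorem WittRelations.combine_three (h : WittRelations x y X Y b w v A B)
    (n p q g g0 g1 g2 g00 g01 g02 g12 g22 : ℂ)
    (r1 : w * g0 + A * B * g2 = q * g) (r2 : v * g1 + A * B * g2 = p * g)
    (r10 : g0 + w * g00 + A * B * g02 = q * g0) (r20 : v * g01 + A * B * g02 = p * g0)
    (r12 : w * g02 + g2 + A * B * g22 = q * g2) (r22 : v * g12 + g2 + A * B * g22 = p * g2)
    (hg : g01 = (1 - (n + p + q)) * g2 + A * B * g22) :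
    (-(n + p + q) * g0 + A * B * g02) • (y * Y * x) +
        (A * (-(n + p + q) * g2 + g2 + A * B * g22)) • (y * Y * y) +
        (-(n + p + q) * g + A * B * g2) • (y * b) +
        (g00 * B) • (x * Y * x) + (A * g02 * B + g0) • (x * Y * y) + (g0 * B) • (x * b) +
        (g01 * B) • (y * X * x) + (A * g12 * B + g1) • (y * X * y) +
        (g02 * B * B) • (x * X * x) + (A * g22 * B * B + 2 * g2 * B) • (x * X * y) +
        (g0 * B) • ((n • 1 - b) * x) + (A * g2 * B + g) • ((n • 1 - b) * y) =
      (n + p + q + 1) • (((g0 + v * g2) * B) • x - (q * g) • y - g0 • (x * y * Y) -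
        (g2 * B) • (x * y * X) - g • (b * y)) := by
  have e1 : y * Y * x = w • y + x * y * Y := by
    rw [mul_assoc, h.Yx, mul_sub, ← mul_assoc, h.yx]; simp
  have e2 : y * Y * y = B • y := by
    rw [mul_assoc, h.Yy, mul_sub, ← mul_assoc, h.yy]; simp
  have e3 : x * Y * x = w • x := by
    rw [mul_assoc, h.Yx, mul_sub, ← mul_assoc, h.xx]; simp
  have e4 : x * Y * y = B • x - x * y * Y := by
    rw [mul_assoc, h.Yy, mul_sub, ← mul_assoc]; simp
  have e5 : y * X * x = A • y + x * y * X := by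
    rw [mul_assoc, h.Xx, mul_sub, ← mul_assoc, h.yx]; simp
  have e6 : y * X * y = v • y := by
    rw [mul_assoc, h.Xy, mul_sub, ← mul_assoc, h.yy]; simp
  have e7 : x * X * x = A • x := by
    rw [mul_assoc, h.Xx, mul_sub, ← mul_assoc, h.xx]; simp
  have e8 : x * X * y = v • x - x * y * X := by
    rw [mul_assoc, h.Xy, mul_sub, ← mul_assoc]; simp
  rw [e1, e2, e3, e4, e5, e6, e7, e8, h.xb, h.yb, sub_mul, sub_mul, smul_mul_assoc,
    smul_mul_assoc, one_mul, one_mul]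
  subst hg
  match_scalars
  · linear_combination -(n + p + q) * r1 + A * B * r12 + r2 + A * B * r22
  · ring
  · ring
  · linear_combination B * r10 + B * r20
  · ring
  · ring

theorem WittRelations.combine_four (h : WittRelations x y X Y b w v A B)
    (n p q g g0 g1 g2 g01 g02 g12 g22 f3 f4 : ℂ)
    (r2 : v * g1 + A * B * g2 = p * g) (r20 : v * g01 + A * B * g02 = p * g0)
    (r22 : v * g12 + g2 + A * B * g22 = p * g2)
    (hg : g01 = (1 - (n + p + q)) * g2 + A * B * g22) :
    ((g01 + (g2 + v * g12)) * B) • (x * X) +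
        (A * (g02 + v * g22) * B + (g0 + v * g2)) • (x * Y) -
        ((q * g1) • (y * X) + (q * (A * g2)) • (y * Y) + (q * g) • (n • 1 - b)) -
        (g01 • (x * y * Y * X) + f3 • (x * y * Y * Y) - g0 • (x * ((n • 1 - b) * Y))) -
        (f4 • (x * y * X * X) + (A * g22 * B + g2) • (x * y * X * Y) -
          (g2 * B) • (x * ((n • 1 - b) * X))) -
        (g1 • (b * y * X) + (A * g2) • (b * y * Y) + g • (b * (n • 1 - b))) =
      -(g • ((n • 1 - b + p • 1) * (b + q • 1))) -
        (g2 * A) • ((n • 1 - b + p • 1) * ((1 / 2 : ℂ) • (Y * y - y * Y))) -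
        (g2 * B) • ((n • 1 - b + p • 1) * ((1 / 2 : ℂ) • (X * x - x * X))) +
        g0 • ((n • 1 - b + p • 1) * (x * Y)) + g1 • ((b + q • 1) * (X * y)) +
        ((n + p + q) * g2) • (X * x * Y * y) := by
  have e1 : x * y * Y * X = -(x * y * X * Y) := by
    rw [mul_assoc, h.YX, mul_neg, ← mul_assoc]
  have e2 : x * y * Y * Y = 0 := by rw [mul_assoc, h.YY, mul_zero]
  have e3 : x * y * X * X = 0 := by rw [mul_assoc, h.XX, mul_zero]
  have e4 (Z : R) : x * ((n • 1 - b) * Z) = (n - 1) • (x * Z) - b * (x * Z) := by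
    rw [← mul_assoc, mul_sub, h.xb, sub_mul, add_mul, mul_smul_comm, smul_mul_assoc, mul_one,
      mul_assoc]
    module
  have e5 : x * X * (y * Y) = v • (x * Y) - x * y * X * Y := by
    rw [← mul_assoc, mul_assoc x, h.Xy, mul_sub, sub_mul]
    simp [mul_assoc]
  have e6 : X * x * Y * y = (A * B) • 1 - B • (x * X) - A • (y * Y) + (v • (x * Y) - x * y * X * Y) := by
    rw [mul_assoc, h.Xx, h.Yy, sub_mul, mul_sub, mul_sub, e5]
    simp only [smul_mul_assoc, one_mul, mul_smul_comm, mul_one]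
    module
  rw [e1, e2, e3, e4, e4, e6, h.Xx, h.Xy, h.Yy]
  simp only [add_mul, sub_mul, mul_add, mul_sub, smul_mul_assoc, mul_smul_comm, one_mul, mul_one,
    smul_sub, smul_add, mul_assoc]
  subst hg
  match_scalars
  · linear_combination B * r22
  · linear_combination r20
  · ring
  · ring
  · linear_combination -q * r2
  · linear_combination -r2
  all_goals ring

end WittRelations

/-- The coefficient of `((x - 1) / 2) ^ j` in the Jacobi polynomial `P_{j+i}^{a,b}`. -/
def jacobiCoeff (a b j i : ℕ) : ℂ := (a + j + i).choose i * (a + b + j + i + j).choose j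

/-- The homogenized Jacobi polynomial `t ^ k * P_k^{a,b} (2 r / t - 1)`. -/
def jacobiHom {R : Type*} [CommRing R] [Algebra ℂ R] (k a b : ℕ) (r t : R) : R :=
  ∑ x ∈ Finset.HasAntidiagonal.antidiagonal k,
    jacobiCoeff a b x.1 x.2 • ((r - t) ^ x.1 * t ^ x.2)

theorem jacobiCoeff_eq (a b j i : ℕ) : jacobiCoeff a b j i =
    ((a + j + i).factorial / ((a + j).factorial * i.factorial) : ℂ) *
      ((a + b + j + i + j).factorial / ((a + b + j + i).factorial * j.factorial)) := by
  rw [jacobiCoeff, ← Nat.choose_symm_add, (Nat.choose_symm_add (a := a + b + j + i)).symm,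
    Nat.cast_add_choose, Nat.cast_add_choose]

theorem cast_factorial_succ (m : ℕ) :
    ((m + 1).factorial : ℂ) = ((m : ℂ) + 1) * m.factorial := by
  rw [Nat.factorial_succ]; push_cast; ring

theorem succ_mul_jacobiCoeff (a b j i : ℕ) : ((j : ℂ) + 1) * jacobiCoeff a b (j + 1) i =
    ((a : ℂ) + b + (j + i : ℕ) + 2) * jacobiCoeff (a + 1) (b + 1) j i := by
  rw [jacobiCoeff_eq, jacobiCoeff_eq,
    show a + (j + 1) + i = a + j + i + 1 by ring, show a + (j + 1) = a + j + 1 by ring,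
    show a + b + (j + 1) + i + (j + 1) = a + b + j + i + j + 1 + 1 by ring,
    show a + b + (j + 1) + i = a + b + j + i + 1 by ring,
    show a + 1 + j + i = a + j + i + 1 by ring, show a + 1 + j = a + j + 1 by ring,
    show a + 1 + (b + 1) + j + i + j = a + b + j + i + j + 1 + 1 by ring,
    show a + 1 + (b + 1) + j + i = a + b + j + i + 1 + 1 by ring]
  simp only [cast_factorial_succ]
  push_cast
  have e1 : (a : ℂ) + b + j + i + 1 + 1 ≠ 0 := by
    exact_mod_cast Nat.succ_ne_zero (a + b + j + i + 1)
  have e2 : (a : ℂ) + b + j + i + 1 ≠ 0 := by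
    exact_mod_cast Nat.succ_ne_zero (a + b + j + i)
  have e3 : (a : ℂ) + j + 1 ≠ 0 := by
    exact_mod_cast Nat.succ_ne_zero (a + j)
  have e4 : (j : ℂ) + 1 ≠ 0 := by
    exact_mod_cast Nat.succ_ne_zero (j)
  have f (m : ℕ) : (m.factorial : ℂ) ≠ 0 := by exact_mod_cast m.factorial_ne_zero
  have f1 := f (a + j)
  have f2 := f (a + b + j + i)
  have f3 := f i
  have f4 := f j
  field_simp
  ring

theorem jacobiCoeff_deriv_right (a b j i : ℕ) :
    ((i : ℂ) + 1) * jacobiCoeff a b j (i + 1) - ((j : ℂ) + 1) * jacobiCoeff a b (j + 1) i =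
      -((j + i : ℕ) + 1 + b : ℂ) * jacobiCoeff (a + 1) b j i := by
  rw [jacobiCoeff_eq, jacobiCoeff_eq, jacobiCoeff_eq,
    show a + (j + 1) + i = a + j + i + 1 by ring, show a + (j + 1) = a + j + 1 by ring,
    show a + b + (j + 1) + i + (j + 1) = a + b + j + i + j + 1 + 1 by ring,
    show a + b + (j + 1) + i = a + b + j + i + 1 by ring,
    show a + j + (i + 1) = a + j + i + 1 by ring,
    show a + b + j + (i + 1) + j = a + b + j + i + j + 1 by ring,
    show a + b + j + (i + 1) = a + b + j + i + 1 by ring,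
    show a + 1 + j + i = a + j + i + 1 by ring, show a + 1 + j = a + j + 1 by ring,
    show a + 1 + b + j + i + j = a + b + j + i + j + 1 by ring,
    show a + 1 + b + j + i = a + b + j + i + 1 by ring]
  simp only [cast_factorial_succ]
  push_cast
  have e2 : (a : ℂ) + b + j + i + 1 ≠ 0 := by
    exact_mod_cast Nat.succ_ne_zero (a + b + j + i)
  have e3 : (a : ℂ) + j + 1 ≠ 0 := by
    exact_mod_cast Nat.succ_ne_zero (a + j)
  have e4 : (j : ℂ) + 1 ≠ 0 := by
    exact_mod_cast Nat.succ_ne_zero (j)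
  have e5 : (i : ℂ) + 1 ≠ 0 := by
    exact_mod_cast Nat.succ_ne_zero (i)
  have f (m : ℕ) : (m.factorial : ℂ) ≠ 0 := by exact_mod_cast m.factorial_ne_zero
  have f1 := f (a + j)
  have f2 := f (a + b + j + i)
  have f3 := f i
  have f4 := f j
  field_simp
  ring

theorem jacobiCoeff_contiguous_left (a b j i : ℕ) :
    ((b : ℂ) + 1 + j) * jacobiCoeff a (b + 1) j (i + 1) +
        ((j : ℂ) + 1) * jacobiCoeff a (b + 1) (j + 1) i =
      ((b : ℂ) + (j + i : ℕ) + 2) * jacobiCoeff (a + 1) b j (i + 1) := by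
  rw [jacobiCoeff_eq, jacobiCoeff_eq, jacobiCoeff_eq,
    show a + (j + 1) + i = a + j + i + 1 by ring, show a + (j + 1) = a + j + 1 by ring,
    show a + (b + 1) + (j + 1) + i + (j + 1) = a + b + j + i + j + 1 + 1 + 1 by ring,
    show a + (b + 1) + (j + 1) + i = a + b + j + i + 1 + 1 by ring,
    show a + j + (i + 1) = a + j + i + 1 by ring,
    show a + (b + 1) + j + (i + 1) + j = a + b + j + i + j + 1 + 1 by ring,
    show a + (b + 1) + j + (i + 1) = a + b + j + i + 1 + 1 by ring,
    show a + 1 + j + (i + 1) = a + j + i + 1 + 1 by ring, show a + 1 + j = a + j + 1 by ring,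
    show a + 1 + b + j + (i + 1) + j = a + b + j + i + j + 1 + 1 by ring,
    show a + 1 + b + j + (i + 1) = a + b + j + i + 1 + 1 by ring]
  simp only [cast_factorial_succ]
  push_cast
  have e1 : (a : ℂ) + b + j + i + 1 + 1 ≠ 0 := by
    exact_mod_cast Nat.succ_ne_zero (a + b + j + i + 1)
  have e2 : (a : ℂ) + b + j + i + 1 ≠ 0 := by
    exact_mod_cast Nat.succ_ne_zero (a + b + j + i)
  have e3 : (a : ℂ) + j + 1 ≠ 0 := by
    exact_mod_cast Nat.succ_ne_zero (a + j)
  have e4 : (j : ℂ) + 1 ≠ 0 := by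
    exact_mod_cast Nat.succ_ne_zero (j)
  have e5 : (i : ℂ) + 1 ≠ 0 := by
    exact_mod_cast Nat.succ_ne_zero (i)
  have f (m : ℕ) : (m.factorial : ℂ) ≠ 0 := by exact_mod_cast m.factorial_ne_zero
  have f1 := f (a + j)
  have f2 := f (a + b + j + i)
  have f3 := f i
  have f4 := f j
  field_simp
  ring

theorem jacobiCoeff_contiguous_right (a b j i : ℕ) :
    ((a : ℂ) + b + (j + i : ℕ) + 2) * jacobiCoeff (a + 1) b j (i + 1) =
      ((a : ℂ) + b + 2 * (j + i : ℕ) + 3) * jacobiCoeff a b j (i + 1) +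
        ((b : ℂ) + (j + i : ℕ) + 1) * jacobiCoeff (a + 1) b j i := by
  rw [jacobiCoeff_eq, jacobiCoeff_eq, jacobiCoeff_eq,
    show a + j + (i + 1) = a + j + i + 1 by ring,
    show a + b + j + (i + 1) + j = a + b + j + i + j + 1 by ring,
    show a + b + j + (i + 1) = a + b + j + i + 1 by ring,
    show a + 1 + j + (i + 1) = a + j + i + 1 + 1 by ring,
    show a + 1 + j + i = a + j + i + 1 by ring, show a + 1 + j = a + j + 1 by ring,
    show a + 1 + b + j + (i + 1) + j = a + b + j + i + j + 1 + 1 by ring,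
    show a + 1 + b + j + (i + 1) = a + b + j + i + 1 + 1 by ring,
    show a + 1 + b + j + i + j = a + b + j + i + j + 1 by ring,
    show a + 1 + b + j + i = a + b + j + i + 1 by ring]
  simp only [cast_factorial_succ]
  push_cast
  have e1 : (a : ℂ) + b + j + i + 1 + 1 ≠ 0 := by
    exact_mod_cast Nat.succ_ne_zero (a + b + j + i + 1)
  have e2 : (a : ℂ) + b + j + i + 1 ≠ 0 := by
    exact_mod_cast Nat.succ_ne_zero (a + b + j + i)
  have e3 : (a : ℂ) + j + 1 ≠ 0 := by
    exact_mod_cast Nat.succ_ne_zero (a + j)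
  have e5 : (i : ℂ) + 1 ≠ 0 := by
    exact_mod_cast Nat.succ_ne_zero (i)
  have f (m : ℕ) : (m.factorial : ℂ) ≠ 0 := by exact_mod_cast m.factorial_ne_zero
  have f1 := f (a + j)
  have f2 := f (a + b + j + i)
  have f3 := f i
  have f4 := f j
  field_simp
  ring

theorem jacobiCoeff_contiguous_right_top (a b k : ℕ) :
    ((a : ℂ) + b + k + 2) * jacobiCoeff (a + 1) b (k + 1) 0 =
      ((a : ℂ) + b + 2 * k + 3) * jacobiCoeff a b (k + 1) 0 := by
  rw [jacobiCoeff_eq, jacobiCoeff_eq,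
    show a + (k + 1) + 0 = a + k + 1 by ring, show a + (k + 1) = a + k + 1 by ring,
    show a + b + (k + 1) + 0 + (k + 1) = a + b + k + k + 1 + 1 by ring,
    show a + b + (k + 1) + 0 = a + b + k + 1 by ring,
    show a + 1 + (k + 1) + 0 = a + k + 1 + 1 by ring, show a + 1 + (k + 1) = a + k + 1 + 1 by ring,
    show a + 1 + b + (k + 1) + 0 + (k + 1) = a + b + k + k + 1 + 1 + 1 by ring,
    show a + 1 + b + (k + 1) + 0 = a + b + k + 1 + 1 by ring]
  simp only [cast_factorial_succ]
  push_cast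
  have e1 : (a : ℂ) + b + k + 1 + 1 ≠ 0 := by
    exact_mod_cast Nat.succ_ne_zero (a + b + k + 1)
  have e2 : (a : ℂ) + b + k + 1 ≠ 0 := by
    exact_mod_cast Nat.succ_ne_zero (a + b + k)
  have e3 : (a : ℂ) + k + 1 ≠ 0 := by
    exact_mod_cast Nat.succ_ne_zero (a + k)
  have e4 : (k : ℂ) + 1 ≠ 0 := by
    exact_mod_cast Nat.succ_ne_zero (k)
  have e5 : (a : ℂ) + k + 1 + 1 ≠ 0 := by
    exact_mod_cast Nat.succ_ne_zero (a + k + 1)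
  have f (m : ℕ) : (m.factorial : ℂ) ≠ 0 := by exact_mod_cast m.factorial_ne_zero
  have f1 := f (a + k)
  have f2 := f (a + b + k)
  have f4 := f k
  field_simp
  ring

section CommRing

variable {R : Type*} [CommRing R] [Algebra ℂ R] (k a b : ℕ) (r t : R)

theorem derivation_jacobiHom_succ (D : Derivation ℂ R R) :
    D (jacobiHom (k + 1) a b r t) =
      ((a : ℂ) + b + k + 2) • (D r * jacobiHom k (a + 1) (b + 1) r t) -
        ((k : ℂ) + 1 + b) • (D t * jacobiHom k (a + 1) b r t) := by
  have key : D (jacobiHom (k + 1) a b r t) =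
      ∑ x ∈ Finset.HasAntidiagonal.antidiagonal (k + 1),
        ((x.1 : ℂ) * jacobiCoeff a b x.1 x.2) • ((r - t) ^ (x.1 - 1) * t ^ x.2 * (D r - D t)) +
      ∑ x ∈ Finset.HasAntidiagonal.antidiagonal (k + 1),
        ((x.2 : ℂ) * jacobiCoeff a b x.1 x.2) • ((r - t) ^ x.1 * t ^ (x.2 - 1) * D t) := by
    rw [jacobiHom, map_sum, ← Finset.sum_add_distrib]
    refine Finset.sum_congr rfl fun x _ => ?_
    rw [D.map_smul]
    simp only [Derivation.leibniz, Derivation.leibniz_pow, map_sub, smul_eq_mul, nsmul_eq_mul]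
    simp only [Algebra.smul_def, map_mul, map_natCast]
    ring
  rw [key, Finset.Nat.sum_antidiagonal_succ, Finset.Nat.sum_antidiagonal_succ']
  simp only [jacobiHom, Finset.mul_sum, Finset.smul_sum, Nat.cast_zero, zero_mul, zero_smul,
    zero_add]
  rw [← Finset.sum_add_distrib, ← Finset.sum_sub_distrib]
  refine Finset.sum_congr rfl fun x hx => ?_
  obtain rfl := (Finset.HasAntidiagonal.mem_antidiagonal.1 hx).symm
  have h1 := succ_mul_jacobiCoeff a b x.1 x.2
  have h2 := jacobiCoeff_deriv_right a b x.1 x.2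
  apply_fun algebraMap ℂ R at h1 h2
  simp only [Algebra.smul_def, add_tsub_cancel_right]
  push_cast at h1 h2 ⊢
  simp only [map_add, map_mul, map_sub, map_neg, map_natCast, map_one, map_ofNat] at h1 h2 ⊢
  linear_combination ((r - t) ^ x.1 * t ^ x.2 * D r) * h1 + ((r - t) ^ x.1 * t ^ x.2 * D t) * h2

theorem derivation_jacobiHom_of_homogeneous (D : Derivation ℂ R R) (hr : D r = r) (ht : D t = t) :
    D (jacobiHom k a b r t) = (k : ℂ) • jacobiHom k a b r t := by
  rw [jacobiHom, map_sum, Finset.smul_sum]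
  refine Finset.sum_congr rfl fun x hx => ?_
  obtain rfl := (Finset.HasAntidiagonal.mem_antidiagonal.1 hx).symm
  have h (s : R) (hs : D s = s) (i : ℕ) : D (s ^ i) = (i : R) * s ^ i := by
    rcases i with _ | i
    · simp
    · simp only [Derivation.leibniz_pow, hs, add_tsub_cancel_right, nsmul_eq_mul, smul_eq_mul]
      ring
  rw [D.map_smul, Derivation.leibniz, h t ht, h (r - t) (by rw [map_sub, hr, ht])]
  simp only [smul_eq_mul]
  simp only [Algebra.smul_def, Nat.cast_add, map_add, map_natCast]
  ring

theorem jacobiHom_contiguous_left :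
    ((b : ℂ) + 1) • jacobiHom (k + 1) a (b + 1) r t +
        ((a : ℂ) + b + k + 3) • (r * jacobiHom k (a + 1) (b + 2) r t) =
      ((b : ℂ) + k + 2) • jacobiHom (k + 1) (a + 1) b r t := by
  have key : ((a : ℂ) + b + k + 3) • (r * jacobiHom k (a + 1) (b + 2) r t) =
      ∑ x ∈ Finset.HasAntidiagonal.antidiagonal (k + 1),
        ((x.1 : ℂ) * jacobiCoeff a (b + 1) x.1 x.2) • ((r - t) ^ x.1 * t ^ x.2) +
      ∑ x ∈ Finset.HasAntidiagonal.antidiagonal k,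
        (((x.1 : ℂ) + 1) * jacobiCoeff a (b + 1) (x.1 + 1) x.2) •
          ((r - t) ^ x.1 * t ^ (x.2 + 1)) := by
    rw [Finset.Nat.sum_antidiagonal_succ, jacobiHom]
    simp only [Finset.mul_sum, Finset.smul_sum, Nat.cast_zero, zero_mul, zero_smul, zero_add]
    rw [← Finset.sum_add_distrib]
    refine Finset.sum_congr rfl fun x hx => ?_
    obtain rfl := (Finset.HasAntidiagonal.mem_antidiagonal.1 hx).symm
    have h1 := succ_mul_jacobiCoeff a (b + 1) x.1 x.2
    apply_fun algebraMap ℂ R at h1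
    simp only [Algebra.smul_def]
    push_cast at h1 ⊢
    simp only [map_add, map_mul, map_natCast, map_one, map_ofNat] at h1 ⊢
    linear_combination (-(r - t) ^ x.1 * t ^ x.2 * r) * h1
  rw [key, jacobiHom, jacobiHom, Finset.Nat.sum_antidiagonal_succ',
    Finset.Nat.sum_antidiagonal_succ', Finset.Nat.sum_antidiagonal_succ']
  have top : jacobiCoeff (a + 1) b (k + 1) 0 = jacobiCoeff a (b + 1) (k + 1) 0 := by
    simp only [jacobiCoeff, Nat.choose_zero_right]
    rw [show a + 1 + b = a + (b + 1) by ring]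
  have hsum : ((b : ℂ) + 1) • ∑ x ∈ Finset.HasAntidiagonal.antidiagonal k,
        jacobiCoeff a (b + 1) x.1 (x.2 + 1) • ((r - t) ^ x.1 * t ^ (x.2 + 1)) +
      ∑ x ∈ Finset.HasAntidiagonal.antidiagonal k,
        ((x.1 : ℂ) * jacobiCoeff a (b + 1) x.1 (x.2 + 1)) • ((r - t) ^ x.1 * t ^ (x.2 + 1)) +
      ∑ x ∈ Finset.HasAntidiagonal.antidiagonal k,
        (((x.1 : ℂ) + 1) * jacobiCoeff a (b + 1) (x.1 + 1) x.2) •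
          ((r - t) ^ x.1 * t ^ (x.2 + 1)) =
      ((b : ℂ) + k + 2) • ∑ x ∈ Finset.HasAntidiagonal.antidiagonal k,
        jacobiCoeff (a + 1) b x.1 (x.2 + 1) • ((r - t) ^ x.1 * t ^ (x.2 + 1)) := by
    simp only [Finset.smul_sum]
    rw [← Finset.sum_add_distrib, ← Finset.sum_add_distrib]
    refine Finset.sum_congr rfl fun x hx => ?_
    obtain rfl := (Finset.HasAntidiagonal.mem_antidiagonal.1 hx).symm
    match_scalars
    have := jacobiCoeff_contiguous_left a b x.1 x.2
    push_cast at this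
    linear_combination this
  rw [smul_add, smul_add, ← hsum, top]
  push_cast
  module

theorem jacobiHom_contiguous_right :
    ((a : ℂ) + b + k + 2) • jacobiHom (k + 1) (a + 1) b r t =
      ((a : ℂ) + b + 2 * k + 3) • jacobiHom (k + 1) a b r t +
        ((b : ℂ) + k + 1) • (t * jacobiHom k (a + 1) b r t) := by
  have hsum : ((a : ℂ) + b + k + 2) • ∑ x ∈ Finset.HasAntidiagonal.antidiagonal k,
        jacobiCoeff (a + 1) b x.1 (x.2 + 1) • ((r - t) ^ x.1 * t ^ (x.2 + 1)) =
      ((a : ℂ) + b + 2 * k + 3) • ∑ x ∈ Finset.HasAntidiagonal.antidiagonal k,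
        jacobiCoeff a b x.1 (x.2 + 1) • ((r - t) ^ x.1 * t ^ (x.2 + 1)) +
      ((b : ℂ) + k + 1) • (t * jacobiHom k (a + 1) b r t) := by
    simp only [jacobiHom, Finset.mul_sum, Finset.smul_sum]
    rw [← Finset.sum_add_distrib]
    refine Finset.sum_congr rfl fun x hx => ?_
    obtain rfl := (Finset.HasAntidiagonal.mem_antidiagonal.1 hx).symm
    have h := jacobiCoeff_contiguous_right a b x.1 x.2
    apply_fun algebraMap ℂ R at h
    simp only [Algebra.smul_def]
    push_cast at h ⊢
    simp only [map_add, map_mul, map_natCast, map_one, map_ofNat] at h ⊢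
    linear_combination ((r - t) ^ x.1 * t ^ (x.2 + 1)) * h
  have top := jacobiCoeff_contiguous_right_top a b k
  rw [jacobiHom, Finset.Nat.sum_antidiagonal_succ', jacobiHom.eq_def (k + 1) a b,
    Finset.Nat.sum_antidiagonal_succ', smul_add, smul_add, hsum, smul_smul, smul_smul, top]
  abel

end CommRing

/-- The homogenized Jacobi polynomial evaluated at numbers with `r = t s`. -/
theorem jacobiHom_eq_jacobiP (k a b : ℕ) (t s : ℂ) :
    jacobiHom k a b (t * s) t = t ^ k * jacobiP k a b (2 * s - 1) := by
  rw [jacobiHom, jacobiP, Finset.Nat.sum_antidiagonal_eq_sum_range_succ_mk, Finset.mul_sum,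
    Finset.mul_sum]
  refine Finset.sum_congr rfl fun j hj => ?_
  obtain ⟨i, rfl⟩ : ∃ i, k = j + i := ⟨k - j, by grind⟩
  have hΓ (m : ℕ) (x : ℝ) (hx : x = m + 1) : Real.Gamma x = m.factorial := by
    rw [hx, Real.Gamma_nat_eq_factorial]
  rw [hΓ (a + j + i) _ (by push_cast; ring), hΓ (a + b + j + i) _ (by push_cast; ring),
    hΓ (a + b + j + i + j) _ (by push_cast; ring), hΓ (a + j) _ (by push_cast; ring),
    add_tsub_cancel_left, jacobiCoeff_eq]
  push_cast
  rw [Nat.cast_add_choose]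
  have f (m : ℕ) : (m.factorial : ℂ) ≠ 0 := by exact_mod_cast m.factorial_ne_zero
  have f1 := f (a + j)
  have f2 := f (a + b + j + i)
  have f3 := f i
  have f4 := f j
  have f5 := f (j + i)
  rw [smul_eq_mul, show t * s - t = t * (s - 1) by ring,
    show (2 * s - 1 - 1) / 2 = s - 1 by ring, mul_pow, pow_add]
  field_simp

/-- The function `φ` of `u` is, to first order, a function of `⟨z, u⟩`, `⟨u, z⟩` and `⟨u, u⟩` with
partial derivatives `a`, `b` and `c`. -/
def HasInvariantDeriv (φ : (Fin n → ℂ) → ℂ) (a b c : ℂ) (z u : Fin n → ℂ) : Prop :=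
  HasWirtScalar φ (fun j => b * conj (z j) + c * conj (u j)) (fun j => a * z j + c * u j) u

namespace HasInvariantDeriv

variable {φ ψ : (Fin n → ℂ) → ℂ} {a b c a' b' c' : ℂ} {z u : Fin n → ℂ}

theorem const (k : ℂ) : HasInvariantDeriv (fun _ => k) 0 0 0 z u :=
  (HasWirtScalar.const k).congr_derivs (by funext; simp) (by funext; simp)

theorem mul (h : HasInvariantDeriv φ a b c z u) (h' : HasInvariantDeriv ψ a' b' c' z u) :
    HasInvariantDeriv (fun u => φ u * ψ u) (a * ψ u + φ u * a') (b * ψ u + φ u * b')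
      (c * ψ u + φ u * c') z u :=
  (HasWirtScalar.mul h h').congr_derivs (by funext; ring) (by funext; ring)

theorem add (h : HasInvariantDeriv φ a b c z u) (h' : HasInvariantDeriv ψ a' b' c' z u) :
    HasInvariantDeriv (fun u => φ u + ψ u) (a + a') (b + b') (c + c') z u :=
  (HasWirtScalar.add h h').congr_derivs (by funext; simp; ring) (by funext; simp; ring)

theorem const_mul (k : ℂ) (h : HasInvariantDeriv φ a b c z u) :
    HasInvariantDeriv (fun u => k * φ u) (k * a) (k * b) (k * c) z u := by
  simpa using (const k).mul h

theorem herm_left : HasInvariantDeriv (fun u => herm u z) 0 1 0 z u := by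
  refine (HasWirtScalar.sum Finset.univ fun j _ => (HasWirtScalar.coord j).mul
    (HasWirtScalar.const (conj (z j)))).congr_derivs ?_ ?_
  · funext k; simp [Pi.single_apply]
  · funext k; simp

theorem herm_right : HasInvariantDeriv (fun u => herm z u) 1 0 0 z u := by
  have h := HasWirtScalar.star (herm_left (z := z) (u := u))
  simp only [conj_herm] at h
  exact h.congr_derivs (by funext; simp) (by funext; simp)

theorem herm_self : HasInvariantDeriv (fun u => herm u u) 0 0 1 z u := by
  refine (HasWirtScalar.sum Finset.univ fun j _ => (HasWirtScalar.coord j).mul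
    (HasWirtScalar.coord j).star).congr_derivs ?_ ?_
  · funext k; simp [Pi.single_apply]
  · funext k; simp [Pi.single_apply]

end HasInvariantDeriv

/-- The value of a polynomial in `⟨z, u⟩`, its conjugate and `⟨z, z⟩ ⟨u, u⟩`. -/
noncomputable def evalInv (P : MvPolynomial (Fin 3) ℂ) (z u : Fin n → ℂ) : ℂ :=
  MvPolynomial.eval (fun i => ![herm z u, herm u z, herm z z * herm u u] i) P

theorem evalInv_right (P : MvPolynomial (Fin 3) ℂ) (z u : Fin n → ℂ) :
    HasInvariantDeriv (fun u => evalInv P z u) (evalInv (MvPolynomial.pderiv 0 P) z u)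
      (evalInv (MvPolynomial.pderiv 1 P) z u) (herm z z * evalInv (MvPolynomial.pderiv 2 P) z u) z u := by
  have h (i : Fin 3) : HasInvariantDeriv
      (fun u : Fin n → ℂ => ![herm z u, herm u z, herm z z * herm u u] i)
      (![1, 0, 0] i) (![0, 1, 0] i) (![0, 0, herm z z] i) z u := by
    fin_cases i
    · exact .herm_right
    · exact .herm_left
    · simpa using HasInvariantDeriv.herm_self.const_mul (herm z z)
  refine (HasWirtScalar.eval P h).congr_derivs ?_ ?_ <;>
  · funext j
    simp [Fin.sum_univ_three, evalInv]
    ring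

theorem evalInv_left (P : MvPolynomial (Fin 3) ℂ) (z u : Fin n → ℂ) :
    HasInvariantDeriv (fun z => evalInv P z u) (evalInv (MvPolynomial.pderiv 1 P) z u)
      (evalInv (MvPolynomial.pderiv 0 P) z u) (herm u u * evalInv (MvPolynomial.pderiv 2 P) z u) u z := by
  have h (i : Fin 3) : HasInvariantDeriv
      (fun z : Fin n → ℂ => ![herm z u, herm u z, herm z z * herm u u] i)
      (![0, 1, 0] i) (![1, 0, 0] i) (![0, 0, herm u u] i) u z := by
    fin_cases i
    · exact .herm_left
    · exact .herm_right
    · simpa [mul_comm] using HasInvariantDeriv.herm_self.const_mul (herm u u)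
  refine (HasWirtScalar.eval P h).congr_derivs ?_ ?_ <;>
  · funext j
    simp [Fin.sum_univ_three, evalInv]
    ring

section Sums

variable (z u : Fin n → ℂ) (a c s : ℂ) (W : Cl n) (V : Fin n → Cl n)

theorem sum_mul_f : ∑ j, ((a * z j + c * u j) • W + s • V j) * f j =
    a • (W * vec z) + c • (W * vec u) + s • ∑ j, V j * f j := by
  simp only [vec, Finset.mul_sum, Finset.smul_sum, ← Finset.sum_add_distrib]
  refine Finset.sum_congr rfl fun j _ => ?_
  simp only [add_mul, smul_mul_assoc, mul_smul_comm]
  module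

theorem sum_f_mul : ∑ j, f j * ((a * z j + c * u j) • W + s • V j) =
    a • (vec z * W) + c • (vec u * W) + s • ∑ j, f j * V j := by
  simp only [vec, Finset.sum_mul, Finset.smul_sum, ← Finset.sum_add_distrib]
  refine Finset.sum_congr rfl fun j _ => ?_
  simp only [mul_add, smul_mul_assoc, mul_smul_comm]
  module

theorem sum_mul_fDag : ∑ j, ((a * conj (z j) + c * conj (u j)) • W + s • V j) * fDag j =
    a • (W * vecDag z) + c • (W * vecDag u) + s • ∑ j, V j * fDag j := by
  simp only [vecDag, Finset.mul_sum, Finset.smul_sum, ← Finset.sum_add_distrib]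
  refine Finset.sum_congr rfl fun j _ => ?_
  simp only [add_mul, smul_mul_assoc, mul_smul_comm]
  module

theorem sum_fDag_mul : ∑ j, fDag j * ((a * conj (z j) + c * conj (u j)) • W) =
    a • (vecDag z * W) + c • (vecDag u * W) := by
  simp only [vecDag, Finset.sum_mul, Finset.smul_sum, ← Finset.sum_add_distrib]
  refine Finset.sum_congr rfl fun j _ => ?_
  simp only [smul_mul_assoc, mul_smul_comm]
  module

end Sums

theorem diracL_scalar {φ : (Fin n → ℂ) → ℂ} {a b c : ℂ} {z u : Fin n → ℂ}
    (h : HasInvariantDeriv φ a b c u z) :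
    diracL (fun x => algebraMap ℂ (Cl n) (φ x)) z = b • vecDag u + c • vecDag z := by
  simp only [Algebra.algebraMap_eq_smul_one]
  rw [(HasWirt.smul_const h (1 : Cl n)).diracL_eq, sum_fDag_mul, mul_one, mul_one]

theorem diracDagL_smul_vecDag {φ ψ : (Fin n → ℂ) → ℂ} {a b c a' b' c' : ℂ} {z u : Fin n → ℂ}
    (h : HasInvariantDeriv φ a b c u z) (h' : HasInvariantDeriv ψ a' b' c' u z) :
    diracDagL (fun x => φ x • vecDag u + ψ x • vecDag x) z =
      a • (vec u * vecDag u) + c • (vec z * vecDag u) + a' • (vec u * vecDag z) +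
        c' • (vec z * vecDag z) + ψ z • ((n : ℂ) • 1 - beta n) := by
  have H := (HasWirt.smul h (.const (vecDag u))).add (HasWirt.smul h' .vecDag)
  rw [H.diracDagL_eq]
  simp only [Pi.add_apply, mul_add (f _), Finset.sum_add_distrib]
  simp only [← mul_add (f _), ← Finset.sum_add_distrib, sum_f_mul, sum_f_mul_fDag]
  simp only [Pi.zero_apply, mul_zero, Finset.sum_const_zero, smul_zero]
  module

theorem diracDagR_invariant {h p q r s : (Fin n → ℂ) → ℂ} {hw hv hB pw pv pB qw qv qB rw rv rB sw
    sv sB : ℂ} {z u : Fin n → ℂ} (Hh : HasInvariantDeriv h hw hv hB z u)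
    (Hp : HasInvariantDeriv p pw pv pB z u) (Hq : HasInvariantDeriv q qw qv qB z u)
    (Hr : HasInvariantDeriv r rw rv rB z u) (Hs : HasInvariantDeriv s sw sv sB z u) :
    diracDagR (fun y => h y • (vec y * vecDag y) + p y • (vec z * vecDag y) +
        q y • (vec y * vecDag z) + r y • (vec z * vecDag z) +
        s y • ((n : ℂ) • 1 - beta n)) u =
      hw • (vec u * vecDag u * vec z) + hB • (vec u * vecDag u * vec u) +
        h u • (vec u * beta n) +
        pw • (vec z * vecDag u * vec z) + pB • (vec z * vecDag u * vec u) +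
        p u • (vec z * beta n) +
        qw • (vec u * vecDag z * vec z) + qB • (vec u * vecDag z * vec u) +
        rw • (vec z * vecDag z * vec z) + rB • (vec z * vecDag z * vec u) +
        sw • (((n : ℂ) • 1 - beta n) * vec z) + sB • (((n : ℂ) • 1 - beta n) * vec u) := by
  have H := ((((HasWirt.smul Hh (.mul .vec .vecDag)).add
    (HasWirt.smul Hp (.const_mul (vec z) .vecDag))).add
    (HasWirt.smul Hq (.mul_const .vec (vecDag z)))).add
    (HasWirt.smul Hr (.const (vec z * vecDag z)))).add
    (HasWirt.smul Hs (.const ((n : ℂ) • 1 - beta n)))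
  have hβ (x : Cl n) : ∑ j, x * fDag j * f j = x * beta n := by
    simp only [beta, Finset.mul_sum, mul_assoc]
  rw [H.diracDagR_eq]
  simp only [Pi.add_apply, add_mul _ _ (f _), Finset.sum_add_distrib]
  simp only [← add_mul _ _ (f _), ← Finset.sum_add_distrib, sum_mul_f]
  simp only [Pi.zero_apply, zero_mul, zero_add, Finset.sum_const_zero, smul_zero, add_zero,
    hβ]
  module

theorem diracR_invariant {φ ψ χ ω η : (Fin n → ℂ) → ℂ} {φw φv φB ψw ψv ψB χw χv χB ωw ωv ωB ηw
    ηv ηB : ℂ} {z u : Fin n → ℂ} (hφ : HasInvariantDeriv φ φw φv φB z u)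
    (hψ : HasInvariantDeriv ψ ψw ψv ψB z u) (hχ : HasInvariantDeriv χ χw χv χB z u)
    (hω : HasInvariantDeriv ω ωw ωv ωB z u) (hη : HasInvariantDeriv η ηw ηv ηB z u) :
    diracR (fun y => φ y • vec z + ψ y • vec y + χ y • (vec z * vec y * vecDag y) +
        ω y • (vec z * vec y * vecDag z) + η y • (beta n * vec y)) u =
      φv • (vec z * vecDag z) + φB • (vec z * vecDag u) +
        (ψv • (vec u * vecDag z) + ψB • (vec u * vecDag u) + ψ u • ((n : ℂ) • 1 - beta n)) +
        (χv • (vec z * vec u * vecDag u * vecDag z) + χB • (vec z * vec u * vecDag u * vecDag u) -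
          χ u • (vec z * (((n : ℂ) • 1 - beta n) * vecDag u))) +
        (ωv • (vec z * vec u * vecDag z * vecDag z) + ωB • (vec z * vec u * vecDag z * vecDag u) -
          ω u • (vec z * (((n : ℂ) • 1 - beta n) * vecDag z))) +
        (ηv • (beta n * vec u * vecDag z) + ηB • (beta n * vec u * vecDag u) +
          η u • (beta n * ((n : ℂ) • 1 - beta n))) := by
  have H := ((((HasWirt.smul hφ (.const (vec z))).add (HasWirt.smul hψ .vec)).add
    (HasWirt.smul hχ (.mul (.const_mul (vec z) .vec) .vecDag))).add
    (HasWirt.smul hω (.mul_const (.const_mul (vec z) .vec) (vecDag z)))).add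
    (HasWirt.smul hη (.const_mul (beta n) .vec))
  have hβ : ∑ j, beta n * f j * fDag j = beta n * ((n : ℂ) • 1 - beta n) := by
    simp only [← sum_f_mul_fDag, Finset.mul_sum, mul_assoc]
  have hN (x : Fin n → ℂ) : ∑ j, vec z * f j * vecDag x * fDag j =
      (-1 : ℂ) • (vec z * (((n : ℂ) • 1 - beta n) * vecDag x)) := by
    have h1 := sum_f_mul_vecDag_mul_fDag x
    simp only [mul_assoc] at h1 ⊢
    rw [← Finset.mul_sum, h1, ← mul_smul_comm]
    congr 1
    module
  rw [H.diracR_eq]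
  simp only [Pi.add_apply, add_mul _ _ (fDag _), Finset.sum_add_distrib]
  simp only [← add_mul _ _ (fDag _), ← Finset.sum_add_distrib, sum_mul_fDag]
  simp only [Pi.zero_apply, zero_mul, mul_zero, Finset.sum_const_zero, smul_zero, add_zero,
    hβ, hN, sum_f_mul_fDag]
  module

theorem wittRelations_vec (z u : Fin n → ℂ) :
    WittRelations (vec z) (vec u) (vecDag z) (vecDag u) (beta n) (herm z u) (herm u z) (herm z z)
      (herm u u) where
  xx := vec_mul_self z
  yy := vec_mul_self u
  XX := vecDag_mul_self z
  YY := vecDag_mul_self u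
  yx := vec_mul_vec u z
  YX := vecDag_mul_vecDag u z
  Xx := by rw [vecDag_mul_vec, conj_herm]
  Xy := by rw [vecDag_mul_vec, conj_herm]
  Yx := by rw [vecDag_mul_vec, conj_herm]
  Yy := by rw [vecDag_mul_vec, conj_herm]
  xb := vec_mul_beta z
  yb := vec_mul_beta u
  Xb := vecDag_mul_beta z
  Yb := vecDag_mul_beta u

/-- The right-hand side of the explicit expression for `∂_z† ∂_z F ∂_u† ∂_u`, in terms of the values
`g`, `g0`, `g1`, `g2` of `∂_t F` and of its derivatives. -/
noncomputable def kernelExpr (p q g g0 g1 g2 : ℂ) (z u : Fin n → ℂ) : Cl n :=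
  ((n : ℂ) + p + q + 1) • (
    (-g) • (((n : ℂ) • 1 - beta n + p • 1) * (beta n + q • 1)) -
      (g2 * herm z z) • (((n : ℂ) • 1 - beta n + p • 1) * wedge (vecDag u) (vec u)) -
      (g2 * herm u u) • (((n : ℂ) • 1 - beta n + p • 1) * wedge (vecDag z) (vec z)) +
      g0 • (((n : ℂ) • 1 - beta n + p • 1) * (vec z * vecDag u)) +
      g1 • ((beta n + q • 1) * (vecDag z * vec u)) +
      (((n : ℂ) + p + q) * g2) • (vecDag z * vec z * vecDag u * vec u))

theorem pderiv_comm {σ : Type*} (i j : σ) (P : MvPolynomial σ ℂ) :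
    MvPolynomial.pderiv i (MvPolynomial.pderiv j P) =
      MvPolynomial.pderiv j (MvPolynomial.pderiv i P) := by
  classical
  induction P using MvPolynomial.induction_on with
  | C c => simp
  | add P Q hP hQ => simp [hP, hQ]
  | mul_X P k hP =>
    simp only [Derivation.leibniz, MvPolynomial.pderiv_X, smul_eq_mul, map_add, hP,
      Pi.single_apply]
    split_ifs <;> simp <;> ring

open MvPolynomial in
theorem fourDirac_evalInv (F : MvPolynomial (Fin 3) ℂ) (p q : ℂ)
    (hH : MvPolynomial.pderiv 1 (MvPolynomial.pderiv 0 F) =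
      -(C (n + p + q) * MvPolynomial.pderiv 2 F) +
        X 2 * MvPolynomial.pderiv 2 (MvPolynomial.pderiv 2 F))
    (hR1 : X 0 * MvPolynomial.pderiv 0 (MvPolynomial.pderiv 2 F) +
      X 2 * MvPolynomial.pderiv 2 (MvPolynomial.pderiv 2 F) = C q * MvPolynomial.pderiv 2 F)
    (hR2 : X 1 * MvPolynomial.pderiv 1 (MvPolynomial.pderiv 2 F) +
      X 2 * MvPolynomial.pderiv 2 (MvPolynomial.pderiv 2 F) = C p * MvPolynomial.pderiv 2 F)
    (z u : Fin n → ℂ) :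
    fourDirac (evalInv F) z u =
      kernelExpr p q (evalInv (MvPolynomial.pderiv 2 F) z u)
        (evalInv (MvPolynomial.pderiv 0 (MvPolynomial.pderiv 2 F)) z u)
        (evalInv (MvPolynomial.pderiv 1 (MvPolynomial.pderiv 2 F)) z u)
        (evalInv (MvPolynomial.pderiv 2 (MvPolynomial.pderiv 2 F)) z u) z u := by
  have c20 := pderiv_comm 2 0 F
  set G := MvPolynomial.pderiv 2 F with hG
  set G0 := MvPolynomial.pderiv 0 G with hG0
  set G1 := MvPolynomial.pderiv 1 G
  set G2 := MvPolynomial.pderiv 2 G with hG2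
  have eadd (P Q : MvPolynomial (Fin 3) ℂ) (u : Fin n → ℂ) :
      evalInv (P + Q) z u = evalInv P z u + evalInv Q z u := by simp [evalInv]
  have eneg (P : MvPolynomial (Fin 3) ℂ) (u : Fin n → ℂ) :
      evalInv (-P) z u = -evalInv P z u := by simp [evalInv]
  have emul (P Q : MvPolynomial (Fin 3) ℂ) (u : Fin n → ℂ) :
      evalInv (P * Q) z u = evalInv P z u * evalInv Q z u := by simp [evalInv]
  have eC (k : ℂ) (u : Fin n → ℂ) : evalInv (C k) z u = k := by simp [evalInv]
  have e0 (u : Fin n → ℂ) : evalInv (X 0) z u = herm z u := by simp [evalInv]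
  have e1 (u : Fin n → ℂ) : evalInv (X 1) z u = herm u z := by simp [evalInv]
  have e2 (u : Fin n → ℂ) : evalInv (X 2) z u = herm z z * herm u u := by simp [evalInv]
  have d01 : MvPolynomial.pderiv 0 G1 = MvPolynomial.pderiv 1 G0 := pderiv_comm _ _ _
  have d02 : MvPolynomial.pderiv 0 G2 = MvPolynomial.pderiv 2 G0 := pderiv_comm _ _ _
  have d12 : MvPolynomial.pderiv 1 G2 = MvPolynomial.pderiv 2 G1 := pderiv_comm _ _ _
  have ev {P Q : MvPolynomial (Fin 3) ℂ} (h : P = Q) (u : Fin n → ℂ) :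
      evalInv P z u = evalInv Q z u := by rw [h]
  have hH0 := congrArg (MvPolynomial.pderiv 0) hH
  have hH2 := congrArg (MvPolynomial.pderiv 2) hH
  have hR10 := congrArg (MvPolynomial.pderiv 0) hR1
  have hR12 := congrArg (MvPolynomial.pderiv 2) hR1
  have hR20 := congrArg (MvPolynomial.pderiv 0) hR2
  have hR22 := congrArg (MvPolynomial.pderiv 2) hR2
  have hg : MvPolynomial.pderiv 1 G0 = MvPolynomial.pderiv 2
      (MvPolynomial.pderiv 1 (MvPolynomial.pderiv 0 F)) := by
    rw [pderiv_comm 2 1, c20]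
  rw [hH2] at hg
  simp only [map_add, map_neg, Derivation.leibniz, pderiv_C, pderiv_X, smul_eq_mul,
    ← hG0, ← hG2, d01, d02] at hH0 hH2 hR10 hR12 hR20 hR22 hg
  simp only [Pi.single_apply, Fin.reduceEq, if_true, if_false, mul_zero, mul_one, add_zero]
    at hH0 hH2 hR10 hR12 hR20 hR22 hg
  have fH := ev hH
  have fH0 := ev hH0
  have fH2 := ev hH2
  have f1 := ev hR1
  have f2 := ev hR2
  have f10 := ev hR10
  have f12 := ev hR12
  have f20 := ev hR20
  have f22 := ev hR22
  have fg := ev hg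
  simp only [eadd, eneg, emul, eC, e0, e1, e2] at fH fH0 fH2 f1 f2 f10 f12 f20 f22 fg
  have hM : (fun y => diracDagL (diracL fun x => algebraMap ℂ (Cl n) (evalInv F x y)) z) =
      fun y => evalInv (MvPolynomial.pderiv 1 (MvPolynomial.pderiv 0 F)) z y •
          (vec y * vecDag y) +
        (herm y y * evalInv G0 z y) • (vec z * vecDag y) +
        (herm y y * evalInv G1 z y) • (vec y * vecDag z) +
        (herm y y * (herm y y * evalInv G2 z y)) • (vec z * vecDag z) +
        (herm y y * evalInv G z y) • ((n : ℂ) • 1 - beta n) := by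
    funext y
    have hL : (diracL fun x => algebraMap ℂ (Cl n) (evalInv F x y)) = fun x =>
        evalInv (MvPolynomial.pderiv 0 F) x y • vecDag y +
          (herm y y * evalInv G x y) • vecDag x :=
      funext fun x => diracL_scalar (evalInv_left F x y)
    rw [hL, diracDagL_smul_vecDag (evalInv_left _ z y) ((evalInv_left G z y).const_mul (herm y y)), c20]
  have hM1 : diracDagR (fun y => diracDagL (diracL fun x => algebraMap ℂ (Cl n) (evalInv F x y)) z) =
      fun y => (((n : ℂ) + p + q + 1) * ((evalInv G0 z y + herm y z * evalInv G2 z y) *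
          herm y y)) • vec z +
        (((n : ℂ) + p + q + 1) * (-q * evalInv G z y)) • vec y +
        (((n : ℂ) + p + q + 1) * (-1 * evalInv G0 z y)) • (vec z * vec y * vecDag y) +
        (((n : ℂ) + p + q + 1) * (-1 * (evalInv G2 z y * herm y y))) •
          (vec z * vec y * vecDag z) +
        (((n : ℂ) + p + q + 1) * (-1 * evalInv G z y)) • (beta n * vec y) := by
    funext y
    rw [hM, diracDagR_invariant (evalInv_right _ z y)
      (HasInvariantDeriv.herm_self.mul (evalInv_right G0 z y))
      (HasInvariantDeriv.herm_self.mul (evalInv_right G1 z y))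
      (HasInvariantDeriv.herm_self.mul (HasInvariantDeriv.herm_self.mul (evalInv_right G2 z y)))
      (HasInvariantDeriv.herm_self.mul (evalInv_right G z y))]
    have key := (wittRelations_vec z y).combine_three n p q (evalInv G z y) (evalInv G0 z y)
      (evalInv G1 z y) (evalInv G2 z y) (evalInv (MvPolynomial.pderiv 0 G0) z y)
      (evalInv (MvPolynomial.pderiv 1 G0) z y) (evalInv (MvPolynomial.pderiv 2 G0) z y)
      (evalInv (MvPolynomial.pderiv 2 G1) z y) (evalInv (MvPolynomial.pderiv 2 G2) z y)
      (f1 y) (f2 y) (by linear_combination f10 y) (f20 y) (by linear_combination f12 y)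
      (by linear_combination f22 y) (by linear_combination fg y)
    refine Eq.trans ?_ (key.trans ?_)
    · rw [fH, fH0, fH2]
      simp only [← hG0, ← hG2, d01, d02]
      match_scalars <;> ring
    · module
  have key := (wittRelations_vec z u).combine_four n p q (evalInv G z u) (evalInv G0 z u)
      (evalInv G1 z u) (evalInv G2 z u)
      (evalInv (MvPolynomial.pderiv 1 G0) z u) (evalInv (MvPolynomial.pderiv 2 G0) z u)
      (evalInv (MvPolynomial.pderiv 2 G1) z u) (evalInv (MvPolynomial.pderiv 2 G2) z u)
      (herm z z * evalInv (MvPolynomial.pderiv 2 G0) z u)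
      (evalInv (MvPolynomial.pderiv 2 G1) z u * herm u u)
      (f2 u) (f20 u) (by linear_combination f22 u) (by linear_combination fg u)
  rw [fourDirac, hM1, diracR_invariant
    ((((evalInv_right G0 z u).add (HasInvariantDeriv.herm_left.mul (evalInv_right G2 z u))).mul
      HasInvariantDeriv.herm_self).const_mul _)
    (((evalInv_right G z u).const_mul _).const_mul _)
    (((evalInv_right G0 z u).const_mul _).const_mul _)
    ((((evalInv_right G2 z u).mul HasInvariantDeriv.herm_self).const_mul _).const_mul _)
    (((evalInv_right G z u).const_mul _).const_mul _)]
  refine Eq.trans ?_ ((congrArg (fun x => ((n : ℂ) + p + q + 1) • x) key).trans ?_)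
  · simp only [← hG2, d12]
    match_scalars <;> ring
  · simp only [kernelExpr, wedge]
    module

theorem conjCl_smul (c : ℂ) (X : Cl n) : conjCl (c • X) = conj c • conjCl X := by
  induction X using TensorProduct.induction_on with
  | zero => rw [smul_zero, map_zero, smul_zero]
  | tmul a x => simp [conjCl, TensorProduct.smul_tmul']
  | add x y hx hy => rw [smul_add, map_add, map_add, hx, hy, smul_add]

theorem dagger_smul (c : ℂ) (X : Cl n) : dagger (c • X) = conj c • dagger X := by
  induction X using TensorProduct.induction_on with
  | zero => rw [smul_zero, map_zero, smul_zero]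
  | tmul a x => simp [dagger, TensorProduct.smul_tmul']
  | add x y hx hy => rw [smul_add, map_add, map_add, hx, hy, smul_add]

theorem dagger_mul (X Y : Cl n) : dagger (X * Y) = dagger Y * dagger X := by
  induction X using TensorProduct.induction_on with
  | zero => rw [zero_mul, map_zero, mul_zero]
  | tmul a x =>
    induction Y using TensorProduct.induction_on with
    | zero => rw [mul_zero, map_zero, zero_mul]
    | tmul b y => simp [dagger, mul_comm]
    | add x y hx hy => rw [mul_add, map_add, map_add, hx, hy, add_mul]
  | add x y hx hy => rw [add_mul, map_add, map_add, hx, hy, mul_add]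

theorem conjCl_conjCl (X : Cl n) : conjCl (conjCl X) = X := by
  induction X using TensorProduct.induction_on with
  | zero => rw [map_zero, map_zero]
  | tmul a x => simp [conjCl]
  | add x y hx hy => rw [map_add, map_add, hx, hy]

theorem dagger_conjCl (X : Cl n) : dagger (conjCl X) = conjCl (dagger X) := by
  induction X using TensorProduct.induction_on with
  | zero => simp only [map_zero]
  | tmul a x => simp [conjCl, dagger]
  | add x y hx hy => rw [map_add, map_add, map_add, map_add, hx, hy]

theorem conjCl_e (i : Fin (n + n)) : conjCl (e i : Cl n) = e i := by
  simp [conjCl, e]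

theorem dagger_e (i : Fin (n + n)) : dagger (e i : Cl n) = (-1 : ℂ) • e i := by
  simp [dagger, e, TensorProduct.tmul_neg]

theorem conjCl_f (j : Fin n) : conjCl (f j : Cl n) = (-1 : ℂ) • fDag j := by
  rw [f, fDag_eq, conjCl_smul, map_sub, conjCl_smul, conjCl_e, conjCl_e]
  simp only [map_div₀, map_one, map_ofNat, Complex.conj_I]
  module

theorem conjCl_fDag (j : Fin n) : conjCl (fDag j : Cl n) = (-1 : ℂ) • f j := by
  rw [f, fDag_eq, conjCl_smul, map_add, conjCl_smul, conjCl_e, conjCl_e]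
  simp only [map_div₀, map_neg, map_one, map_ofNat, Complex.conj_I]
  module

theorem dagger_f (j : Fin n) : dagger (f j : Cl n) = fDag j := by
  rw [f, fDag_eq, dagger_smul, map_sub, dagger_smul, dagger_e, dagger_e]
  simp only [map_div₀, map_one, map_ofNat, Complex.conj_I]
  module

theorem dagger_fDag (j : Fin n) : dagger (fDag j : Cl n) = f j := by
  rw [f, fDag_eq, dagger_smul, map_add, dagger_smul, dagger_e, dagger_e]
  simp only [map_div₀, map_neg, map_one, map_ofNat, Complex.conj_I]
  module

theorem vecDag_eq_neg_conjCl (z : Fin n → ℂ) : vecDag z = -conjCl (vec z) := by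
  rw [← neg_one_smul ℂ, vec, vecDag, map_sum, Finset.smul_sum]
  refine Finset.sum_congr rfl fun j _ => ?_
  rw [conjCl_smul, conjCl_f]
  module

/-- The `ℂ`-linear anti-automorphism with `e_j ↦ -e_j`. -/
noncomputable def cliffordConj : Cl n →ₗ[ℂ] Cl n where
  toFun X := conjCl (dagger X)
  map_add' X Y := by rw [map_add, map_add]
  map_smul' c X := by rw [dagger_smul, conjCl_smul, Complex.conj_conj, RingHom.id_apply]

theorem cliffordConj_mul (X Y : Cl n) :
    cliffordConj (X * Y) = cliffordConj Y * cliffordConj X := by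
  simp only [cliffordConj, LinearMap.coe_mk, AddHom.coe_mk, dagger_mul, map_mul]

theorem cliffordConj_one : cliffordConj (1 : Cl n) = 1 := by
  simp [cliffordConj, dagger, conjCl, Algebra.TensorProduct.one_def]

theorem cliffordConj_f (j : Fin n) : cliffordConj (f j : Cl n) = (-1 : ℂ) • f j := by
  simp only [cliffordConj, LinearMap.coe_mk, AddHom.coe_mk, dagger_f, conjCl_fDag]

theorem cliffordConj_fDag (j : Fin n) : cliffordConj (fDag j : Cl n) = (-1 : ℂ) • fDag j := by
  simp only [cliffordConj, LinearMap.coe_mk, AddHom.coe_mk, dagger_fDag, conjCl_f]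

theorem cliffordConj_vec (z : Fin n → ℂ) : cliffordConj (vec z) = (-1 : ℂ) • vec z := by
  simp only [vec, map_sum, map_smul, cliffordConj_f, Finset.smul_sum]
  exact Finset.sum_congr rfl fun j _ => by module

theorem cliffordConj_vecDag (z : Fin n → ℂ) : cliffordConj (vecDag z) = (-1 : ℂ) • vecDag z := by
  simp only [vecDag, map_sum, map_smul, cliffordConj_fDag, Finset.smul_sum]
  exact Finset.sum_congr rfl fun j _ => by module

theorem cliffordConj_beta : cliffordConj (beta n) = (n : ℂ) • 1 - beta n := by
  rw [← sum_f_mul_fDag, beta, map_sum]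
  refine Finset.sum_congr rfl fun j _ => ?_
  rw [cliffordConj_mul, cliffordConj_f, cliffordConj_fDag, smul_mul_smul_comm]
  module

theorem WittRelations.reverse {R : Type*} [Ring R] [Algebra ℂ R] {x y X Y b : R} {w v A B : ℂ}
    (h : WittRelations x y X Y b w v A B) (n p q g g0 g1 g2 : ℂ) :
    (-g) • ((n • 1 - b + p • 1) * (b + q • 1)) -
        (g2 * B) • ((1 / 2 : ℂ) • (x * X - X * x) * (b + q • 1)) -
        (g2 * A) • ((1 / 2 : ℂ) • (y * Y - Y * y) * (b + q • 1)) +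
        g1 • (X * y * (b + q • 1)) + g0 • (x * Y * (n • 1 - b + p • 1)) +
        ((n + p + q) * g2) • (x * X * y * Y) =
      (-g) • ((n • 1 - b + p • 1) * (b + q • 1)) -
        (g2 * A) • ((n • 1 - b + p • 1) * ((1 / 2 : ℂ) • (Y * y - y * Y))) -
        (g2 * B) • ((n • 1 - b + p • 1) * ((1 / 2 : ℂ) • (X * x - x * X))) +
        g0 • ((n • 1 - b + p • 1) * (x * Y)) + g1 • ((b + q • 1) * (X * y)) +
        ((n + p + q) * g2) • (X * x * Y * y) := by
  have comm (s S : R) (hs : s * b = b * s + s) (hS : S * b = b * S - S) :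
      s * (S * b) = b * (s * S) := by
    rw [hS, mul_sub, ← mul_assoc, hs, add_mul, mul_assoc, add_sub_cancel_right]
  have e5 : x * X * (y * Y) = v • (x * Y) - x * y * X * Y := by
    rw [← mul_assoc, mul_assoc x, h.Xy, mul_sub, sub_mul]
    simp [mul_assoc]
  have e6 : X * x * Y * y =
      (A * B) • 1 - B • (x * X) - A • (y * Y) + (v • (x * Y) - x * y * X * Y) := by
    rw [mul_assoc, h.Xx, h.Yy, sub_mul, mul_sub, mul_sub, e5]
    simp only [smul_mul_assoc, one_mul, mul_smul_comm, mul_one]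
    module
  rw [e6, mul_assoc (x * X), e5, h.Xx, h.Xy, h.Yy]
  simp only [add_mul, sub_mul, mul_add, mul_sub, smul_mul_assoc, mul_smul_comm, one_mul, mul_one,
    smul_sub, smul_add, mul_assoc, comm x X h.xb h.Xb, comm y Y h.yb h.Yb, comm x Y h.xb h.Yb,
    comm y X h.yb h.Xb]
  module

theorem cliffordConj_kernelExpr (p q g g0 g1 g2 : ℂ) (z u : Fin n → ℂ) :
    cliffordConj (kernelExpr q p g g1 g0 g2 u z) = kernelExpr p q g g0 g1 g2 z u := by
  have h := (wittRelations_vec z u).reverse n p q g g0 g1 g2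
  simp only [kernelExpr, wedge, map_smul, map_add, map_sub, cliffordConj_mul, cliffordConj_beta,
    cliffordConj_one, cliffordConj_vec, cliffordConj_vecDag]
  rw [show (n : ℂ) + q + p + 1 = n + p + q + 1 by ring, ← h]
  rw [sub_sub_cancel]
  simp only [smul_mul_smul_comm, neg_mul_neg, mul_one, one_smul, ← mul_assoc]
  rw [add_right_comm (n : ℂ) q p]

theorem conjCl_clBasis (A : Finset (Fin (n + n))) : conjCl (clBasis n A) = clBasis n A := by
  simp [conjCl, clBasis]

theorem repr_conjCl (X : Cl n) (A : Finset (Fin (n + n))) :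
    (clBasis n).repr (conjCl X) A = conj ((clBasis n).repr X A) := by
  conv_lhs => rw [← (clBasis n).sum_repr X]
  rw [map_sum]
  simp only [conjCl_smul, conjCl_clBasis]
  rw [Module.Basis.repr_sum_self]

theorem pderiv_conjCl (g : (Fin n → ℂ) → Cl n) (z v : Fin n → ℂ) :
    pderiv (fun w => conjCl (g w)) z v = conjCl (pderiv g z v) := by
  simp only [pderiv, map_sum, conjCl_smul, conjCl_clBasis, repr_conjCl]
  refine Finset.sum_congr rfl fun A _ => ?_
  congr 1
  exact deriv.star (f := fun t : ℝ => (clBasis n).repr (g (z + t • v)) A)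

theorem pderiv_neg (g : (Fin n → ℂ) → Cl n) (z v : Fin n → ℂ) :
    pderiv (fun w => (-1 : ℂ) • g w) z v = (-1 : ℂ) • pderiv g z v := by
  simp only [pderiv, Finset.smul_sum, map_smul, Finsupp.smul_apply]
  refine Finset.sum_congr rfl fun A _ => ?_
  rw [smul_smul]
  congr 1
  exact deriv_const_smul_field (-1 : ℂ) (fun t : ℝ => (clBasis n).repr (g (z + t • v)) A)

theorem dz_conjCl (j : Fin n) (g : (Fin n → ℂ) → Cl n) (z : Fin n → ℂ) :
    dz j (fun w => conjCl (g w)) z = conjCl (dzbar j g z) := by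
  simp only [dz, dzbar, pderiv_conjCl, conjCl_smul, map_add, map_div₀, map_one, map_ofNat,
    Complex.conj_I]
  module

theorem dzbar_conjCl (j : Fin n) (g : (Fin n → ℂ) → Cl n) (z : Fin n → ℂ) :
    dzbar j (fun w => conjCl (g w)) z = conjCl (dz j g z) := by
  simp only [dz, dzbar, pderiv_conjCl, conjCl_smul, map_sub, map_div₀, map_one, map_ofNat,
    Complex.conj_I]
  module

theorem dz_neg (j : Fin n) (g : (Fin n → ℂ) → Cl n) (z : Fin n → ℂ) :
    dz j (fun w => (-1 : ℂ) • g w) z = (-1 : ℂ) • dz j g z := by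
  simp only [dz, pderiv_neg]
  module

theorem dzbar_neg (j : Fin n) (g : (Fin n → ℂ) → Cl n) (z : Fin n → ℂ) :
    dzbar j (fun w => (-1 : ℂ) • g w) z = (-1 : ℂ) • dzbar j g z := by
  simp only [dzbar, pderiv_neg]
  module

theorem diracL_neg (g : (Fin n → ℂ) → Cl n) (z : Fin n → ℂ) :
    diracL (fun w => (-1 : ℂ) • g w) z = (-1 : ℂ) • diracL g z := by
  simp only [diracL, dz_neg, Finset.smul_sum, mul_smul_comm]

theorem diracDagR_neg (g : (Fin n → ℂ) → Cl n) (z : Fin n → ℂ) :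
    diracDagR (fun w => (-1 : ℂ) • g w) z = (-1 : ℂ) • diracDagR g z := by
  simp only [diracDagR, dzbar_neg, Finset.smul_sum, smul_mul_assoc]

theorem conjCl_diracL (g : (Fin n → ℂ) → Cl n) (z : Fin n → ℂ) :
    conjCl (diracL g z) = (-1 : ℂ) • diracDagL (fun w => conjCl (g w)) z := by
  simp only [diracL, diracDagL, dzbar_conjCl, map_sum, map_mul, conjCl_fDag, Finset.smul_sum,
    smul_mul_assoc]

theorem conjCl_diracDagL (g : (Fin n → ℂ) → Cl n) (z : Fin n → ℂ) :
    conjCl (diracDagL g z) = (-1 : ℂ) • diracL (fun w => conjCl (g w)) z := by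
  simp only [diracL, diracDagL, dz_conjCl, map_sum, map_mul, conjCl_f, Finset.smul_sum,
    smul_mul_assoc]

theorem conjCl_diracR (g : (Fin n → ℂ) → Cl n) (z : Fin n → ℂ) :
    conjCl (diracR g z) = (-1 : ℂ) • diracDagR (fun w => conjCl (g w)) z := by
  simp only [diracR, diracDagR, dzbar_conjCl, map_sum, map_mul, conjCl_fDag, Finset.smul_sum,
    mul_smul_comm]

theorem conjCl_diracDagR (g : (Fin n → ℂ) → Cl n) (z : Fin n → ℂ) :
    conjCl (diracDagR g z) = (-1 : ℂ) • diracR (fun w => conjCl (g w)) z := by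
  simp only [diracR, diracDagR, dz_conjCl, map_sum, map_mul, conjCl_f, Finset.smul_sum,
    mul_smul_comm]

theorem diracDagL_eq_neg_conjCl (g : (Fin n → ℂ) → Cl n) (z : Fin n → ℂ) :
    diracDagL g z = -conjCl (diracL (fun w => conjCl (g w)) z) := by
  rw [conjCl_diracL, ← neg_one_smul ℂ, smul_smul]
  simp only [conjCl_conjCl]
  module

theorem diracDagR_eq_neg_conjCl (g : (Fin n → ℂ) → Cl n) (z : Fin n → ℂ) :
    diracDagR g z = -conjCl (diracR (fun w => conjCl (g w)) z) := by
  rw [conjCl_diracR, ← neg_one_smul ℂ, smul_smul]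
  simp only [conjCl_conjCl]
  module

theorem conjCl_algebraMap (c : ℂ) :
    conjCl (algebraMap ℂ (Cl n) c) = algebraMap ℂ (Cl n) (conj c) := by
  rw [Algebra.algebraMap_eq_smul_one, Algebra.algebraMap_eq_smul_one, conjCl_smul, map_one]

theorem fourDirac'_eq_conjCl (F : (Fin n → ℂ) → (Fin n → ℂ) → ℂ) (x y : Fin n → ℂ) :
    fourDirac' F x y = conjCl (fourDirac (fun x y => conj (F x y)) x y) := by
  have h : (-1 : ℂ) * -1 = 1 := by norm_num
  simp only [fourDirac, fourDirac', conjCl_diracR, conjCl_diracDagR, conjCl_diracL,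
    conjCl_diracDagL, diracL_neg, diracDagR_neg, conjCl_algebraMap, Complex.conj_conj, smul_smul,
    h, one_smul]

section KernelPolynomial

open MvPolynomial

/-- The polynomial `c V ^ d ⟨jacobiHom k a d⟩ (W V, T)` in `W = X i`, `V = X j`, `T = X 2`. -/
noncomputable def kernelPoly (i j : Fin 3) (c : ℂ) (k a d : ℕ) : MvPolynomial (Fin 3) ℂ :=
  c • (X j ^ d * jacobiHom k a d (X i * X j) (X 2))

variable {i j : Fin 3} (c : ℂ) (k a d : ℕ)

theorem pderiv_two_kernelPoly (hi : i ≠ 2) (hj : j ≠ 2) :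
    MvPolynomial.pderiv 2 (kernelPoly i j c (k + 1) a d) =
      kernelPoly i j (-(c * (k + 1 + d))) k (a + 1) d := by
  rw [kernelPoly, kernelPoly, Derivation.map_smul, Derivation.leibniz, derivation_jacobiHom_succ]
  simp only [Derivation.leibniz, Derivation.leibniz_pow, pderiv_X_of_ne hi, pderiv_X_of_ne hj,
    pderiv_X_self, smul_eq_mul, mul_zero, zero_mul, smul_zero, add_zero, zero_sub, one_mul,
    mul_neg, mul_smul_comm]
  module

theorem pderiv_fst_kernelPoly (hij : i ≠ j) (hi : i ≠ 2) :
    MvPolynomial.pderiv i (kernelPoly i j c (k + 1) a d) =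
      kernelPoly i j (c * (a + d + k + 2)) k (a + 1) (d + 1) := by
  rw [kernelPoly, kernelPoly, Derivation.map_smul, Derivation.leibniz, derivation_jacobiHom_succ]
  simp only [Derivation.leibniz, Derivation.leibniz_pow, pderiv_X_of_ne hi.symm,
    pderiv_X_of_ne hij.symm, pderiv_X_self, smul_eq_mul, mul_zero, zero_mul, smul_zero, add_zero,
    zero_add, sub_zero, mul_one, mul_smul_comm, pow_succ, mul_assoc]
  module

theorem pderiv_snd_kernelPoly (hij : i ≠ j) (hj : j ≠ 2) :
    MvPolynomial.pderiv j (kernelPoly i j c (k + 1) a (d + 1)) =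
      kernelPoly i j (c * (d + k + 2)) (k + 1) (a + 1) d := by
  have h := congrArg (fun x => c • (X j ^ d * x))
    (jacobiHom_contiguous_left k a d (X i * X j) (X 2 : MvPolynomial (Fin 3) ℂ))
  rw [kernelPoly, kernelPoly, Derivation.map_smul, Derivation.leibniz, derivation_jacobiHom_succ]
  simp only [Derivation.leibniz, Derivation.leibniz_pow, pderiv_X_of_ne hj.symm,
    pderiv_X_of_ne hij, pderiv_X_self, smul_eq_mul, mul_zero, zero_mul, smul_zero, add_zero,
    zero_add, sub_zero, mul_one, mul_smul_comm, smul_add, smul_smul, add_tsub_cancel_right] at h ⊢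
  rw [← h]
  simp only [nsmul_eq_mul, smul_eq_C_mul, map_mul, map_add, map_natCast, map_one, map_ofNat,
    pow_succ]
  push_cast
  ring

theorem X_mul_pderiv_fst_kernelPoly (hij : i ≠ j) (hi : i ≠ 2) (hj : j ≠ 2) :
    X i * MvPolynomial.pderiv i (kernelPoly i j c k a d) +
      X 2 * MvPolynomial.pderiv 2 (kernelPoly i j c k a d) = C (k : ℂ) * kernelPoly i j c k a d := by
  let D : Derivation ℂ (MvPolynomial (Fin 3) ℂ) (MvPolynomial (Fin 3) ℂ) :=
    (X i : MvPolynomial (Fin 3) ℂ) • MvPolynomial.pderiv i +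
      (X 2 : MvPolynomial (Fin 3) ℂ) • MvPolynomial.pderiv 2
  have hD (x) : D x = X i * MvPolynomial.pderiv i x + X 2 * MvPolynomial.pderiv 2 x := rfl
  have hDj : D (X j) = 0 := by
    rw [hD, pderiv_X_of_ne hij.symm, pderiv_X_of_ne hj, mul_zero, mul_zero, add_zero]
  have hDi : D (X i) = X i := by
    rw [hD, pderiv_X_self, pderiv_X_of_ne hi, mul_one, mul_zero, add_zero]
  have hD2 : D (X 2) = X 2 := by
    rw [hD, pderiv_X_self, pderiv_X_of_ne hi.symm, mul_one, mul_zero, zero_add]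
  rw [← hD, kernelPoly, D.map_smul, D.leibniz, D.leibniz_pow, hDj,
    derivation_jacobiHom_of_homogeneous _ _ _ _ _ D _ hD2, ← smul_eq_C_mul]
  · simp only [smul_eq_mul, smul_zero, mul_zero, add_zero, mul_smul_comm]
    module
  · rw [D.leibniz, hDi, hDj, smul_zero, zero_add, smul_eq_mul, mul_comm]

theorem X_mul_pderiv_snd_kernelPoly (hij : i ≠ j) (hi : i ≠ 2) (hj : j ≠ 2) :
    X j * MvPolynomial.pderiv j (kernelPoly i j c k a d) +
      X 2 * MvPolynomial.pderiv 2 (kernelPoly i j c k a d) =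
        C ((d : ℂ) + k) * kernelPoly i j c k a d := by
  let D : Derivation ℂ (MvPolynomial (Fin 3) ℂ) (MvPolynomial (Fin 3) ℂ) :=
    (X j : MvPolynomial (Fin 3) ℂ) • MvPolynomial.pderiv j +
      (X 2 : MvPolynomial (Fin 3) ℂ) • MvPolynomial.pderiv 2
  have hD (x) : D x = X j * MvPolynomial.pderiv j x + X 2 * MvPolynomial.pderiv 2 x := rfl
  have hDi : D (X i) = 0 := by
    rw [hD, pderiv_X_of_ne hij, pderiv_X_of_ne hi, mul_zero, mul_zero, add_zero]
  have hDj : D (X j) = X j := by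
    rw [hD, pderiv_X_self, pderiv_X_of_ne hj, mul_one, mul_zero, add_zero]
  have hD2 : D (X 2) = X 2 := by
    rw [hD, pderiv_X_self, pderiv_X_of_ne hj.symm, mul_one, mul_zero, zero_add]
  have hpow : D (X j ^ d) = (d : ℂ) • X j ^ d := by
    rcases d with _ | d
    · simp
    · rw [D.leibniz_pow, hDj, add_tsub_cancel_right, smul_eq_mul, ← pow_succ,
        Nat.cast_smul_eq_nsmul]
  rw [← hD, kernelPoly, D.map_smul, D.leibniz, hpow,
    derivation_jacobiHom_of_homogeneous _ _ _ _ _ D _ hD2, ← smul_eq_C_mul]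
  · simp only [smul_eq_mul, smul_eq_C_mul, map_add]
    ring
  · rw [D.leibniz, hDj, hDi, smul_zero, add_zero, smul_eq_mul]

theorem pderiv_pderiv_kernelPoly (hij : i ≠ j) (hi : i ≠ 2) (hj : j ≠ 2) :
    MvPolynomial.pderiv j (MvPolynomial.pderiv i (kernelPoly i j c (k + 2) a d)) =
      -(C ((a : ℂ) + d + 2 * k + 4) * MvPolynomial.pderiv 2 (kernelPoly i j c (k + 2) a d)) +
        X 2 * MvPolynomial.pderiv 2 (MvPolynomial.pderiv 2 (kernelPoly i j c (k + 2) a d)) := by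
  have h := congrArg (fun x => (c * (d + k + 2)) • (X j ^ d * x))
    (jacobiHom_contiguous_right k (a + 1) d (X i * X j) (X 2 : MvPolynomial (Fin 3) ℂ))
  rw [pderiv_fst_kernelPoly _ _ _ _ hij hi, pderiv_snd_kernelPoly _ _ _ _ hij hj,
    pderiv_two_kernelPoly _ _ _ _ hi hj, pderiv_two_kernelPoly _ _ _ _ hi hj]
  simp only [kernelPoly, smul_eq_C_mul, map_mul, map_add, map_neg, map_natCast, map_one,
    map_ofNat, Nat.cast_add, Nat.cast_one] at h ⊢
  linear_combination h

end KernelPolynomial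

theorem herm_mul_herm (z u : Fin n → ℂ) :
    herm z u * herm u z = herm z z * herm u u * angular z u := by
  have h0 (z : Fin n → ℂ) (h : herm z z = 0) : z = 0 := by
    have h1 : ∑ j, Complex.normSq (z j) = 0 := by
      have : ((∑ j, Complex.normSq (z j) : ℝ) : ℂ) = 0 := by
        rw [← h, herm]
        push_cast
        exact Finset.sum_congr rfl fun j _ => (Complex.mul_conj _).symm
      exact_mod_cast this
    rw [Finset.sum_eq_zero_iff_of_nonneg fun j _ => Complex.normSq_nonneg _] at h1
    exact funext fun j => Complex.normSq_eq_zero.1 (h1 j (Finset.mem_univ j))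
  rw [angular, conj_herm]
  by_cases hz : herm z z = 0
  · rw [h0 z hz]; simp [herm]
  by_cases hu : herm u u = 0
  · rw [h0 u hu]; simp [herm]
  field_simp

theorem evalInv_kernelPoly (i j : Fin 3) (c : ℂ) (k a d : ℕ) (z u : Fin n → ℂ) :
    evalInv (kernelPoly i j c k a d) z u =
      c * (![herm z u, herm u z, herm z z * herm u u] j ^ d * jacobiHom k a d
        (![herm z u, herm u z, herm z z * herm u u] i *
          ![herm z u, herm u z, herm z z * herm u u] j) (herm z z * herm u u)) := by
  simp [evalInv, kernelPoly, jacobiHom]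

theorem jacobiHom_herm (k a b : ℕ) (z u : Fin n → ℂ) :
    jacobiHom k a b (herm z u * herm u z) (herm z z * herm u u) =
      (herm z z * herm u u) ^ k * jacobiP k a b (2 * angular z u - 1) := by
  rw [herm_mul_herm, jacobiHom_eq_jacobiP]

theorem evalInv_kernelPoly_right (c : ℂ) (k a d : ℕ) (z u : Fin n → ℂ) :
    evalInv (kernelPoly 0 1 c k a d) z u = c * conj (herm z u) ^ d *
      (herm z z * herm u u) ^ k * jacobiP k a d (2 * angular z u - 1) := by
  have h := jacobiHom_herm k a d z u
  rw [evalInv_kernelPoly]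
  simp only [Matrix.cons_val_zero, Matrix.cons_val_one]
  rw [h, conj_herm]
  ring

theorem evalInv_kernelPoly_left (c : ℂ) (k a d : ℕ) (z u : Fin n → ℂ) :
    evalInv (kernelPoly 1 0 c k a d) z u = c * herm z u ^ d *
      (herm z z * herm u u) ^ k * jacobiP k a d (2 * angular z u - 1) := by
  have h := jacobiHom_herm k a d z u
  rw [evalInv_kernelPoly]
  simp only [Matrix.cons_val_zero, Matrix.cons_val_one]
  rw [mul_comm (herm u z), h]
  ring

theorem evalInv_kernelPoly_swap (c : ℂ) (k a d : ℕ) (z u : Fin n → ℂ) :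
    evalInv (kernelPoly 1 0 c k a d) u z = evalInv (kernelPoly 0 1 c k a d) z u := by
  rw [evalInv_kernelPoly, evalInv_kernelPoly]
  simp only [Matrix.cons_val_zero, Matrix.cons_val_one]
  rw [mul_comm (herm z z)]

theorem conj_evalInv_kernelPoly (c : ℂ) (hc : conj c = c) (k a d : ℕ) (z u : Fin n → ℂ) :
    conj (evalInv (kernelPoly 0 1 c k a d) z u) = evalInv (kernelPoly 1 0 c k a d) z u := by
  rw [evalInv_kernelPoly, evalInv_kernelPoly]
  simp only [Matrix.cons_val_zero, Matrix.cons_val_one]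
  simp only [jacobiHom, jacobiCoeff, map_mul, map_pow, map_sum, map_sub, map_natCast, smul_eq_mul,
    conj_herm, hc]

theorem kernelConst_comm (n p q : ℕ) : kernelConst n p q = kernelConst n q p := by
  rw [kernelConst, kernelConst, add_right_comm]

theorem conj_kernelConst (n p q : ℕ) : conj (kernelConst n p q) = kernelConst n p q := by
  simp only [kernelConst, map_div₀, map_add, map_sub, map_natCast, map_ofNat, map_one]

theorem harmonicKernel_right (ν k d : ℕ) (z u : Fin (ν + 2) → ℂ) :
    harmonicKernel (ν + 2) k (k + d + 1) z u =
      evalInv (kernelPoly 0 1 (kernelConst (ν + 2) (k + d + 1) k) k ν (d + 1)) z u := by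
  rw [harmonicKernel, if_neg (by omega), evalInv_kernelPoly_right,
    show k + d + 1 - k = d + 1 by omega, kernelConst_comm,
    show ((ν + 2 : ℕ) : ℝ) - 2 = ν by push_cast; ring,
    show ((k + d + 1 : ℕ) : ℝ) - k = ((d + 1 : ℕ) : ℝ) by push_cast; ring]
  ring

theorem harmonicKernel_left (ν k d : ℕ) (z u : Fin (ν + 2) → ℂ) :
    harmonicKernel (ν + 2) (k + d + 1) k z u =
      evalInv (kernelPoly 1 0 (kernelConst (ν + 2) (k + d + 1) k) k ν (d + 1)) z u := by
  rw [harmonicKernel, if_pos (by omega), evalInv_kernelPoly_left,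
    show k + d + 1 - k = d + 1 by omega,
    show ((ν + 2 : ℕ) : ℝ) - 2 = ν by push_cast; ring,
    show ((k + d + 1 : ℕ) : ℝ) - k = ((d + 1 : ℕ) : ℝ) by push_cast; ring]
  ring

theorem fourDirac_kernelPoly_right (ν k d : ℕ) (c : ℂ) (z u : Fin (ν + 2) → ℂ) :
    fourDirac (evalInv (kernelPoly 0 1 c (k + 2) ν (d + 1))) z u =
      kernelExpr (k + d + 2) (k + 1)
        (evalInv (kernelPoly 0 1 (-(c * (k + d + 3))) (k + 1) (ν + 1) (d + 1)) z u)
        (evalInv (kernelPoly 0 1 (-(c * (k + d + 3) * (ν + d + k + 4))) k (ν + 2) (d + 2)) z u)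
        (evalInv (kernelPoly 0 1 (-(c * (k + d + 3) * (d + k + 2))) (k + 1) (ν + 2) d) z u)
        (evalInv (kernelPoly 0 1 (c * (k + d + 3) * (d + k + 2)) k (ν + 2) (d + 1)) z u) z u := by
  have h2 := pderiv_two_kernelPoly (i := 0) (j := 1) c (k + 1) ν (d + 1) (by decide) (by decide)
  rw [show -(c * (((k + 1 : ℕ) : ℂ) + 1 + ((d + 1 : ℕ) : ℂ))) = -(c * (k + d + 3)) by
    push_cast; ring] at h2
  have h20 := pderiv_fst_kernelPoly (i := 0) (j := 1) (-(c * (k + d + 3))) k (ν + 1) (d + 1)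
    (by decide) (by decide)
  have h21 := pderiv_snd_kernelPoly (i := 0) (j := 1) (-(c * (k + d + 3))) k (ν + 1) d
    (by decide) (by decide)
  have h22 := pderiv_two_kernelPoly (i := 0) (j := 1) (-(c * (k + d + 3))) k (ν + 1) (d + 1)
    (by decide) (by decide)
  have hH := pderiv_pderiv_kernelPoly (i := 0) (j := 1) c k ν (d + 1) (by decide) (by decide)
    (by decide)
  have hR1 := X_mul_pderiv_fst_kernelPoly (i := 0) (j := 1) (-(c * (k + d + 3))) (k + 1) (ν + 1)
    (d + 1) (by decide) (by decide) (by decide)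
  have hR2 := X_mul_pderiv_snd_kernelPoly (i := 0) (j := 1) (-(c * (k + d + 3))) (k + 1) (ν + 1)
    (d + 1) (by decide) (by decide) (by decide)
  rw [fourDirac_evalInv _ (k + d + 2) (k + 1)]
  · rw [h2, h20, h21, h22]
    push_cast
    congr 3 <;> ring
  · rw [hH]
    push_cast
    congr 4
    ring
  · rw [h2, hR1]
    push_cast
    rfl
  · rw [h2, hR2]
    push_cast
    congr 2
    ring

theorem fourDirac_kernelPoly_left (ν k d : ℕ) (c : ℂ) (z u : Fin (ν + 2) → ℂ) :
    fourDirac (evalInv (kernelPoly 1 0 c (k + 2) ν (d + 1))) z u =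
      kernelExpr (k + 1) (k + d + 2)
        (evalInv (kernelPoly 1 0 (-(c * (k + d + 3))) (k + 1) (ν + 1) (d + 1)) z u)
        (evalInv (kernelPoly 1 0 (-(c * (k + d + 3) * (d + k + 2))) (k + 1) (ν + 2) d) z u)
        (evalInv (kernelPoly 1 0 (-(c * (k + d + 3) * (ν + d + k + 4))) k (ν + 2) (d + 2)) z u)
        (evalInv (kernelPoly 1 0 (c * (k + d + 3) * (d + k + 2)) k (ν + 2) (d + 1)) z u) z u := by
  have h2 := pderiv_two_kernelPoly (i := 1) (j := 0) c (k + 1) ν (d + 1) (by decide) (by decide)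
  rw [show -(c * (((k + 1 : ℕ) : ℂ) + 1 + ((d + 1 : ℕ) : ℂ))) = -(c * (k + d + 3)) by
    push_cast; ring] at h2
  have h21 := pderiv_fst_kernelPoly (i := 1) (j := 0) (-(c * (k + d + 3))) k (ν + 1) (d + 1)
    (by decide) (by decide)
  have h20 := pderiv_snd_kernelPoly (i := 1) (j := 0) (-(c * (k + d + 3))) k (ν + 1) d
    (by decide) (by decide)
  have h22 := pderiv_two_kernelPoly (i := 1) (j := 0) (-(c * (k + d + 3))) k (ν + 1) (d + 1)
    (by decide) (by decide)
  have hH := pderiv_pderiv_kernelPoly (i := 1) (j := 0) c k ν (d + 1) (by decide) (by decide)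
    (by decide)
  have hR2 := X_mul_pderiv_fst_kernelPoly (i := 1) (j := 0) (-(c * (k + d + 3))) (k + 1) (ν + 1)
    (d + 1) (by decide) (by decide) (by decide)
  have hR1 := X_mul_pderiv_snd_kernelPoly (i := 1) (j := 0) (-(c * (k + d + 3))) (k + 1) (ν + 1)
    (d + 1) (by decide) (by decide) (by decide)
  rw [fourDirac_evalInv _ (k + 1) (k + d + 2)]
  · rw [h2, h20, h21, h22]
    push_cast
    congr 3 <;> ring
  · rw [pderiv_comm, hH]
    push_cast
    congr 4
    ring
  · rw [h2, hR1]
    push_cast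
    congr 2
    ring
  · rw [h2, hR2]
    push_cast
    rfl

theorem harmonicKernel_conj (ν k d : ℕ) (z u : Fin (ν + 2) → ℂ) :
    harmonicKernel (ν + 2) (k + d + 1) k z u =
      conj (harmonicKernel (ν + 2) k (k + d + 1) z u) := by
  rw [harmonicKernel_left, harmonicKernel_right, conj_evalInv_kernelPoly _ (conj_kernelConst _ _ _)]

theorem harmonicKernel_swap (ν k d : ℕ) (z u : Fin (ν + 2) → ℂ) :
    harmonicKernel (ν + 2) (k + d + 1) k z u = harmonicKernel (ν + 2) k (k + d + 1) u z := by
  rw [harmonicKernel_left, harmonicKernel_right, evalInv_kernelPoly_swap]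

theorem fourDirac_harmonicKernel_eq_conjCl_dagger (ν k d : ℕ) (z u : Fin (ν + 2) → ℂ) :
    fourDirac (harmonicKernel (ν + 2) (k + 2) (k + 2 + d + 1)) z u =
      conjCl (dagger (fourDirac (harmonicKernel (ν + 2) (k + 2 + d + 1) (k + 2)) u z)) := by
  have hr := funext₂ (harmonicKernel_right ν (k + 2) d)
  have hl := funext₂ (harmonicKernel_left ν (k + 2) d)
  rw [hr, hl]
  change _ = cliffordConj _
  rw [fourDirac_kernelPoly_left, fourDirac_kernelPoly_right, cliffordConj_kernelExpr]
  simp only [evalInv_kernelPoly_swap]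

theorem natCast_eq_smul_one {n : ℕ} (m : ℕ) : (m : Cl n) = (m : ℂ) • 1 := by
  rw [Nat.cast_smul_eq_nsmul, nsmul_one]

theorem fourDirac_harmonicKernel (ν k d : ℕ) (z u : Fin (ν + 2) → ℂ) :
    fourDirac (harmonicKernel (ν + 2) (k + 2) (k + 2 + d + 1)) z u =
      kernelExpr (k + d + 2) (k + 1)
        (-(kernelConst (ν + 2) (k + 2 + d + 1) (k + 2) * (k + d + 3)) * conj (herm z u) ^ (d + 1) *
          (herm z z * herm u u) ^ (k + 1) *
          jacobiP (k + 1) (ν + 1 : ℕ) (d + 1 : ℕ) (2 * angular z u - 1))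
        (-(kernelConst (ν + 2) (k + 2 + d + 1) (k + 2) * (k + d + 3) * (ν + d + k + 4)) *
          conj (herm z u) ^ (d + 2) * (herm z z * herm u u) ^ k *
          jacobiP k (ν + 2 : ℕ) (d + 2 : ℕ) (2 * angular z u - 1))
        (-(kernelConst (ν + 2) (k + 2 + d + 1) (k + 2) * (k + d + 3) * (d + k + 2)) *
          conj (herm z u) ^ d * (herm z z * herm u u) ^ (k + 1) *
          jacobiP (k + 1) (ν + 2 : ℕ) d (2 * angular z u - 1))
        (kernelConst (ν + 2) (k + 2 + d + 1) (k + 2) * (k + d + 3) * (d + k + 2) *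
          conj (herm z u) ^ (d + 1) * (herm z z * herm u u) ^ k *
          jacobiP k (ν + 2 : ℕ) (d + 1 : ℕ) (2 * angular z u - 1)) z u := by
  rw [funext₂ (harmonicKernel_right ν (k + 2) d), fourDirac_kernelPoly_right]
  simp only [evalInv_kernelPoly_right]

end HermitianClifford

theorem corollary4p7 (n p q : ℕ) (hn : 2 ≤ n) (hq : 1 ≤ q) (hpq : q < p) :
    -- Hermitian symmetry of the harmonic kernel
    (∀ z u : Fin n → ℂ,
      harmonicKernel n (p + 1) (q + 1) z u = conj (harmonicKernel n (q + 1) (p + 1) z u) ∧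
      harmonicKernel n (p + 1) (q + 1) z u = harmonicKernel n (q + 1) (p + 1) u z) ∧
    -- conjugation exchanges the Dirac operators, and the vector variables, up to sign
    (∀ (g : (Fin n → ℂ) → Cl n) (z : Fin n → ℂ),
      diracDagL g z = -conjCl (diracL (fun w => conjCl (g w)) z) ∧
      diracDagR g z = -conjCl (diracR (fun w => conjCl (g w)) z)) ∧
    (∀ z : Fin n → ℂ, vecDag z = -conjCl (vec z)) ∧
    ∀ z u : Fin n → ℂ,
      -- reduction to the kernel of homogeneity `(p + 1, q + 1)`
      fourDirac (harmonicKernel n (q + 1) (p + 1)) z u =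
        dagger (fourDirac' (fun u' z' => conj (harmonicKernel n (q + 1) (p + 1) z' u')) u z) ∧
      fourDirac (harmonicKernel n (q + 1) (p + 1)) z u =
        conjCl (dagger (fourDirac (harmonicKernel n (p + 1) (q + 1)) u z)) ∧
      -- the explicit expression
      fourDirac (harmonicKernel n (q + 1) (p + 1)) z u =
        (kernelConst n (p + 1) (q + 1) * ((p : ℂ) + 1) * ((n : ℂ) + p + q + 1) *
            conj (herm z u) ^ (p - q - 1) * herm z z ^ (q - 1) * herm u u ^ (q - 1)) •
          ((conj (herm z u) * herm z z * herm u u *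
                jacobiP q ((n : ℝ) - 1) ((p : ℝ) - q) (2 * angular z u - 1)) •
              (((n : Cl n) - beta n + (p : Cl n)) * (beta n + (q : Cl n)))
            - (conj (herm z u) * herm z z * p *
                jacobiP (q - 1) n ((p : ℝ) - q) (2 * angular z u - 1)) •
              (((n : Cl n) - beta n + (p : Cl n)) * wedge (vecDag u) (vec u))
            - (conj (herm z u) * herm u u * p *
                jacobiP (q - 1) n ((p : ℝ) - q) (2 * angular z u - 1)) •
              (((n : Cl n) - beta n + (p : Cl n)) * wedge (vecDag z) (vec z))
            - (conj (herm z u) ^ 2 * ((n : ℂ) + p) *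
                jacobiP (q - 1) n ((p : ℝ) - q + 1) (2 * angular z u - 1)) •
              (((n : Cl n) - beta n + (p : Cl n)) * (vec z * vecDag u))
            - (herm z z * herm u u * p *
                jacobiP q n ((p : ℝ) - q - 1) (2 * angular z u - 1)) •
              ((beta n + (q : Cl n)) * (vecDag z * vec u))
            + (conj (herm z u) * p * ((n : ℂ) + p + q) *
                jacobiP (q - 1) n ((p : ℝ) - q) (2 * angular z u - 1)) •
              (vecDag z * vec z * vecDag u * vec u)) := by
  obtain ⟨ν, rfl⟩ : ∃ ν, n = ν + 2 := ⟨n - 2, by omega⟩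
  obtain ⟨k, rfl⟩ : ∃ k, q = k + 1 := ⟨q - 1, by omega⟩
  obtain ⟨d, rfl⟩ : ∃ d, p = k + d + 2 := ⟨p - k - 2, by omega⟩
  have hk : k + d + 2 + 1 = k + 2 + d + 1 := by ring
  rw [hk, show k + 1 + 1 = k + 2 from rfl]
  refine ⟨fun z u => ⟨harmonicKernel_conj ν (k + 2) d z u, harmonicKernel_swap ν (k + 2) d z u⟩,
    fun g z => ⟨diracDagL_eq_neg_conjCl g z, diracDagR_eq_neg_conjCl g z⟩, vecDag_eq_neg_conjCl,
    fun z u => ?_⟩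
  have h2 := fourDirac_harmonicKernel_eq_conjCl_dagger ν k d z u
  refine ⟨?_, h2, ?_⟩
  · rw [fourDirac'_eq_conjCl, dagger_conjCl, h2]
    simp only [Complex.conj_conj, ← harmonicKernel_swap]
  · rw [fourDirac_harmonicKernel, kernelExpr,
      show k + d + 2 - (k + 1) - 1 = d by omega, add_tsub_cancel_right]
    rw [show ((ν + 2 : ℕ) : ℝ) - 1 = ((ν + 1 : ℕ) : ℝ) by push_cast; ring,
      show ((k + d + 2 : ℕ) : ℝ) - ((k + 1 : ℕ) : ℝ) = ((d + 1 : ℕ) : ℝ) by push_cast; ring,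
      show ((d + 1 : ℕ) : ℝ) + 1 = ((d + 2 : ℕ) : ℝ) by push_cast; ring,
      show ((d + 1 : ℕ) : ℝ) - 1 = (d : ℝ) by push_cast; ring]
    simp only [natCast_eq_smul_one (n := ν + 2)]
    push_cast
    match_scalars <;> ring
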